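/- A standard Young tableau (SYT) $T$ with $n$ cells has descent set $D(T)=\{i : i+1 \text{ is in a lower row than } i\}$; it is alternating if $D(T)=\{1,3,5,\dots\}\cap\{1,\dots,n-1\}$ and reverse alternating if $D(T)=\{2,4,6,\dots\}\cap\{1,\dots,n-1\}$. Let $\mathrm{alt}(\lambda)$ and $\mathrm{ralt}(\lambda)$ be the numbers of alternating and reverse alternating SYT of shape $\lambda$, and let $H_\lambda$ be the product of the hook lengths of $\lambda$. Let $E_n$ be the Euler number, i.e. the number of permutations $a_1a_2\cdots a_n$ of $\{1,\dots,n\}$ with $a_1>a_2<a_3>a_4<\cdots$. Polynomials in the symbol $E$ are evaluated umbrally: expand in powers of $E$, and then replace each $E^n$ by $E_n$. Theorem. Let $m,k\ge 0$ be integers and let $\delta_m=(m-1,m-2,\dots,1)$ be the staircase partition (empty for $m\le 1$). If $m=2k$, then $$\mathrm{alt}(\delta_m)=\mathrm{ralt}(\delta_m)=\frac{1}{H_{\delta_m}}\,E^k\prod_{j=1}^{m-2}(E^2+j^2)^{k-\lceil j/2\rceil}.$$ If $m=2k+1$, then $$\mathrm{alt}(\delta_m)=\mathrm{ralt}(\delta_m)=\frac{1}{H_{\delta_m}}\,E^k\prod_{j=1}^{m-2}(E^2+j^2)^{k-\lfloor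 j/2\rfloor}.$$ (The products are empty, hence equal to $1$, for $m\le 2$.) -/

import Mathlib

open Polynomial

noncomputable section

namespace AlternatingTableaux

/-- The descent set `D(w) = {i ∈ [n-1] | aᵢ > aᵢ₊₁}` of a permutation `w = a₁ a₂ ⋯ aₙ`.
Here `Fin n` is 0-based, so `a` and `b` below are the (1-based) positions `i` and `i + 1`. -/
def permDescentSet {n : ℕ} (w : Equiv.Perm (Fin n)) : Set ℕ :=
  {i | ∃ a b : Fin n, (a : ℕ) + 1 = i ∧ (b : ℕ) = i ∧ w b < w a}

/-- `w = a₁ a₂ ⋯ aₙ` is alternating if `a₁ > a₂ < a₃ > a₄ < ⋯`,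
i.e. if `D(w) = {1, 3, 5, …} ∩ [n-1]`. -/
def IsAlternatingPerm {n : ℕ} (w : Equiv.Perm (Fin n)) : Prop :=
  permDescentSet w = {i | Odd i} ∩ Set.Ico 1 n

/-- The Euler number `Eₙ`: the number of alternating permutations of `n` letters. -/
def eulerNumber (n : ℕ) : ℕ :=
  Nat.card {w : Equiv.Perm (Fin n) // IsAlternatingPerm w}

/-- Umbral evaluation of a polynomial in `E` (the variable `X`): after expansion in powers of `E`,
each `E ^ n` is replaced by the Euler number `Eₙ`. -/
def umbral (p : ℚ[X]) : ℚ :=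
  p.sum fun n a => a * (eulerNumber n : ℚ)

/-- A standard Young tableau of shape `μ`: a filling of the cells of `μ` by `1, …, |μ|`, each used
once, that increases along rows and down columns. As for Mathlib's semistandard tableaux, cell
`(i, j)` is in row `i` and column `j`, larger row indices are lower, and the filling is extended
by zero outside `μ`. -/
structure StandardYoungTableau (μ : YoungDiagram) where
  entry : ℕ × ℕ → ℕ
  bijOn : Set.BijOn entry (μ.cells : Set (ℕ × ℕ)) (Set.Icc 1 μ.card)
  row_strict : ∀ i j₁ j₂ : ℕ, j₁ < j₂ → (i, j₂) ∈ μ → entry (i, j₁) < entry (i, j₂)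
  col_strict : ∀ i₁ i₂ j : ℕ, i₁ < i₂ → (i₂, j) ∈ μ → entry (i₁, j) < entry (i₂, j)
  zeros : ∀ c : ℕ × ℕ, c ∉ μ → entry c = 0

namespace StandardYoungTableau

variable {μ : YoungDiagram}

theorem entry_injective :
    Function.Injective (StandardYoungTableau.entry : StandardYoungTableau μ → ℕ × ℕ → ℕ) := by
  rintro ⟨f, _, _, _, _⟩ ⟨g, _, _, _, _⟩ h
  cases h
  rfl

/-- There are finitely many standard Young tableaux of a given shape. -/
instance : Finite (StandardYoungTableau μ) := by
  let F : StandardYoungTableau μ → (μ.cells → Fin (μ.card + 1)) :=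
    fun T c => ⟨T.entry c, Nat.lt_succ_of_le (T.bijOn.mapsTo c.2).2⟩
  refine Finite.of_injective F fun T T' h => entry_injective (funext fun c => ?_)
  by_cases hc : c ∈ μ
  · exact congrArg Fin.val (congrFun h ⟨c, hc⟩)
  · rw [T.zeros c hc, T'.zeros c hc]

/-- The descent set `D(T)`: all `i` such that `i + 1` is in a lower row of `T` than `i`. -/
def descentSet (T : StandardYoungTableau μ) : Set ℕ :=
  {i | ∃ c ∈ μ, ∃ d ∈ μ, T.entry c = i ∧ T.entry d = i + 1 ∧ c.1 < d.1}

/-- `T` is alternating if `D(T) = {1, 3, 5, …} ∩ [n-1]`, where `n = |μ|`. -/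
def IsAlternating (T : StandardYoungTableau μ) : Prop :=
  T.descentSet = {i | Odd i} ∩ Set.Ico 1 μ.card

/-- `T` is reverse alternating if `D(T) = {2, 4, 6, …} ∩ [n-1]`, where `n = |μ|`. -/
def IsReverseAlternating (T : StandardYoungTableau μ) : Prop :=
  T.descentSet = {i | Even i} ∩ Set.Ico 1 μ.card

end StandardYoungTableau

/-- `alt(μ)`: the number of alternating standard Young tableaux of shape `μ`. -/
def alt (μ : YoungDiagram) : ℕ :=
  Nat.card {T : StandardYoungTableau μ // T.IsAlternating}

/-- `ralt(μ)`: the number of reverse alternating standard Young tableaux of shape `μ`. -/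
def ralt (μ : YoungDiagram) : ℕ :=
  Nat.card {T : StandardYoungTableau μ // T.IsReverseAlternating}

/-- The hook length of the cell `c` of `μ`: the number of cells of `μ` in the same row strictly to
the right, plus the number of cells in the same column strictly below, plus one. -/
def hookLength (μ : YoungDiagram) (c : ℕ × ℕ) : ℕ :=
  (μ.rowLen c.1 - (c.2 + 1)) + (μ.colLen c.2 - (c.1 + 1)) + 1

/-- `H_μ`, the product of the hook lengths of `μ`. -/
def hookProduct (μ : YoungDiagram) : ℕ :=
  ∏ c ∈ μ.cells, hookLength μ c

/-- The staircase `δ_m = (m-1, m-2, …, 1)`, i.e. the cells `(i, j)` with `i, j ≥ 0` and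
`i + j + 1 < m`; it is empty for `m ≤ 1`. -/
def staircase (m : ℕ) : YoungDiagram where
  cells := (Finset.range m ×ˢ Finset.range m).filter fun c => c.1 + c.2 + 1 < m
  isLowerSet := by
    rintro ⟨i, j⟩ ⟨i', j'⟩ h hc
    have h1 : i' ≤ i := h.1
    have h2 : j' ≤ j := h.2
    simp only [Finset.coe_filter, Finset.mem_product, Finset.mem_range, Set.mem_ofPred_eq] at hc ⊢
    omega

end AlternatingTableaux

end

open AlternatingTableaux

/-! Two quantities satisfy the same recurrence. Reading the rows of the entries 1, 2, … of a tableau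
gives a word whose prefix contents are partitions and which has the same descents. A word that
alternates up to an even position and strictly decreases afterwards is an alternating word followed
by a set `B` of letters. Inclusion–exclusion over the start of the decreasing tail expresses the
number of alternating words of content `a` through those of content `a - 1_B`, where `B` is
nonempty, `|B| ≡ n` mod 2, and the sign is `(-1)^((|B|-1)/2)` (`altCount_recurrence`). With content
`(1, …, 1)` and no condition on prefixes this is a recurrence for the Euler numbers
(`eulerRecurrence_eulerNumber`); with partition prefixes it is one for `alt`.

The second solution is the umbral value of `det (g_{ν_i - j})`, `ν_i = a_i + i`, where `∑ g_n x^n =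
exp(E arctan x) / (1 + x²)^(ε/2)` and `ε` is 1 for even `n`, 0 for odd `n` (`altValue_recurrence`).
Multiplying the series for `ε = 1` by `1 ± ix` gives the series for `ε = 0` with `E` shifted by
`±i`; multilinearity in the rows expands the same product into determinants at `a - 1_B` with
weights `(±i)^|B|`. The Euler recurrence says that, umbrally, `p(E+i) + p(E-i) = 2p(0)` for even `p`
and `p(E+i) - p(E-i) = 2i p(E)` for odd `p`, which closes the argument.

For a staircase the `ν_i` are 1, 3, 5, …, and the determinant ignores even factors of the series
(`altDet_mul_even`). The series may therefore be replaced by `(1 + ix)^(-iE)`, and a determinant of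
binomial coefficients remains (`altDet_binomialSeries`). It equals `∏ (E + ic) / H` over the
contents `c` of the cells; opposite contents pair to `E² + c²` and the diagonal cells give `E^k`.
Finally, transposition complements descent sets, so `alt = ralt`. -/

noncomputable section

namespace AlternatingTableaux

open PowerSeries (rescale binomialSeries)

/-! ### Determinants attached to a power series. -/

section AltDet

variable {R : Type*} [CommRing R]

/-- The coefficient of a power series at an integer index, zero at negative indices. -/
def coeffZ (G : PowerSeries R) (n : ℤ) : R :=
  if 0 ≤ n then PowerSeries.coeff n.toNat G else 0

theorem coeffZ_of_neg (G : PowerSeries R) {n : ℤ} (h : n < 0) : coeffZ G n = 0 :=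
  if_neg (not_le.mpr h)

theorem coeffZ_natCast (G : PowerSeries R) (n : ℕ) : coeffZ G n = PowerSeries.coeff n G := by
  simp [coeffZ]

theorem coeffZ_mul_one_add (G : PowerSeries R) (z : R) (n : ℤ) :
    coeffZ (G * (1 + PowerSeries.C z * PowerSeries.X)) n = coeffZ G n + z * coeffZ G (n - 1) := by
  rcases lt_or_ge n 0 with h | h
  · rw [coeffZ_of_neg _ h, coeffZ_of_neg _ h, coeffZ_of_neg _ (by omega)]; simp
  · lift n to ℕ using h
    have e : G * (1 + PowerSeries.C z * PowerSeries.X)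
        = G + PowerSeries.C z * (G * PowerSeries.X) := by ring
    rw [coeffZ_natCast, coeffZ_natCast, e, map_add, PowerSeries.coeff_C_mul]
    cases n with
    | zero => rw [coeffZ_of_neg _ (by simp)]; simp
    | succ n =>
      rw [PowerSeries.coeff_succ_mul_X, show ((n + 1 : ℕ) : ℤ) - 1 = (n : ℕ) by simp,
        coeffZ_natCast]

/-- The determinant `det (g_{νᵢ - j})` attached to a power series `G = ∑ gₙ xⁿ`. -/
def altDet (G : PowerSeries R) {l : ℕ} (ν : Fin l → ℤ) : R :=
  Matrix.det (Matrix.of fun i j : Fin l => coeffZ G (ν i - (j : ℕ)))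

/-- Each new row is the row at `ν i` plus `z` times the row at `ν i - 1`; multilinearity yields one
term for each set `B` of lowered rows. -/
theorem altDet_mul_one_add (G : PowerSeries R) (z : R) {l : ℕ} (ν : Fin l → ℤ) :
    altDet (G * (1 + PowerSeries.C z * PowerSeries.X)) ν =
      ∑ B : Finset (Fin l), z ^ B.card * altDet G (fun i => ν i - if i ∈ B then 1 else 0) := by
  let m : Fin l → Fin l → R := fun i j => coeffZ G (ν i - (j : ℕ))
  let m' : Fin l → Fin l → R := fun i j => z * coeffZ G (ν i - 1 - (j : ℕ))
  have h := (Matrix.detRowAlternating (n := Fin l) (R := R)).toMultilinearMap.map_add_univ m' m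
  have h0 : altDet (G * (1 + PowerSeries.C z * PowerSeries.X)) ν
      = (Matrix.detRowAlternating (n := Fin l) (R := R)).toMultilinearMap (m' + m) := by
    change Matrix.det _ = Matrix.det _
    congr 1
    ext i j
    change coeffZ _ _ = z * coeffZ G (ν i - 1 - (j : ℕ)) + coeffZ G (ν i - (j : ℕ))
    rw [coeffZ_mul_one_add, show ν i - 1 - ((j : ℕ) : ℤ) = ν i - (j : ℕ) - 1 by ring]
    ring
  rw [h0, h]
  refine Finset.sum_congr rfl fun B _ => ?_
  let m'' : Fin l → Fin l → R := fun i j => coeffZ G ((ν i - if i ∈ B then 1 else 0) - (j : ℕ))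
  have h1 : B.piecewise m' m = fun i => (if i ∈ B then z else 1) • m'' i := by
    ext i j
    by_cases hi : i ∈ B <;> simp [hi, m, m', m'']
  rw [h1, MultilinearMap.map_smul_univ]
  simp only [Finset.prod_ite_mem, Finset.univ_inter, Finset.prod_const, smul_eq_mul]
  rfl

theorem altDet_map {S : Type*} [CommRing S] (f : R →+* S) (G : PowerSeries R) {l : ℕ}
    (ν : Fin l → ℤ) : altDet (G.map f) ν = f (altDet G ν) := by
  unfold altDet
  rw [RingHom.map_det]
  congr 1
  ext i j
  simp [coeffZ, apply_ite f]

/-- The entry at `(i, j)` acquires `c ^ (ν i - j)`; the column factors stay on the left to avoid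
inverting `c`. -/
theorem altDet_rescale (c : R) (G : PowerSeries R) {l : ℕ} (ν : Fin l → ℕ) :
    altDet (rescale c G) (fun i => (ν i : ℤ)) * c ^ (∑ i : Fin l, (i : ℕ)) =
      c ^ (∑ i, ν i) * altDet G (fun i => (ν i : ℤ)) := by
  unfold altDet
  rw [← Finset.prod_pow_eq_pow_sum, ← Finset.prod_pow_eq_pow_sum, mul_comm,
    ← Matrix.det_mul_row, ← Matrix.det_mul_column]
  congr 1
  ext i j
  simp only [Matrix.of_apply]
  rcases lt_or_ge (ν i) (j : ℕ) with h | h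
  · rw [coeffZ_of_neg _ (by omega), coeffZ_of_neg _ (by omega)]; simp
  · obtain ⟨d, hd⟩ := Nat.exists_eq_add_of_le h
    rw [hd, show (((j : ℕ) + d : ℕ) : ℤ) - (j : ℕ) = (d : ℕ) by push_cast; ring, coeffZ_natCast,
      coeffZ_natCast, PowerSeries.coeff_rescale]
    ring

theorem altDet_eq_zero_of_row (G : PowerSeries R) {l : ℕ} {ν : Fin l → ℤ} (i : Fin l)
    (h : ν i < 0) : altDet G ν = 0 :=
  Matrix.det_eq_zero_of_row_eq_zero i fun j => coeffZ_of_neg _ (by omega)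

theorem altDet_eq_zero_of_eq (G : PowerSeries R) {l : ℕ} {ν : Fin l → ℤ} {i j : Fin l}
    (hij : i ≠ j) (h : ν i = ν j) : altDet G ν = 0 :=
  Matrix.det_zero_of_row_eq hij (by ext k; simp [h])

theorem altDet_one_eq_zero {l : ℕ} {ν : Fin l → ℤ} (i : Fin l) (h : (l : ℤ) ≤ ν i) :
    altDet (1 : PowerSeries R) ν = 0 := by
  refine Matrix.det_eq_zero_of_row_eq_zero i fun j => ?_
  obtain ⟨d, hd⟩ : ∃ d : ℕ, ν i - (j : ℕ) = ((d + 1 : ℕ) : ℤ) :=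
    ⟨(ν i - (j : ℕ) - 1).toNat, by have := j.2; omega⟩
  rw [Matrix.of_apply, hd, coeffZ_natCast, PowerSeries.coeff_one, if_neg (Nat.succ_ne_zero d)]

theorem altDet_id {G : PowerSeries R} (h : PowerSeries.constantCoeff G = 1) (l : ℕ) :
    altDet G (fun i : Fin l => ((i : ℕ) : ℤ)) = 1 := by
  unfold altDet
  rw [Matrix.det_of_isLowerTriangular]
  · refine Finset.prod_eq_one fun i _ => ?_
    rw [Matrix.of_apply, sub_self, ← Nat.cast_zero, coeffZ_natCast,
      PowerSeries.coeff_zero_eq_constantCoeff_apply, h]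
  · intro i j hij
    have h' : (i : ℕ) < j := hij
    exact coeffZ_of_neg _ (by simp only; omega)

/-- Multiplication by an even series with constant coefficient one does not change the determinant
at the exponents of a staircase. -/
theorem altDet_mul_even (G K : PowerSeries R) (h0 : PowerSeries.constantCoeff K = 1)
    (hK : ∀ n, Odd n → PowerSeries.coeff n K = 0) (l : ℕ) :
    altDet (G * K) (fun i : Fin l => ((2 * (i : ℕ) + 1 : ℕ) : ℤ)) =
      altDet G (fun i : Fin l => ((2 * (i : ℕ) + 1 : ℕ) : ℤ)) := by
  -- The exponents exhaust the odd numbers below `2l`, so an even factor replaces each row by itself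
  -- plus a combination of earlier rows. This unitriangular matrix records the combination.
  have hd : Matrix.det (Matrix.of fun i i' : Fin l => coeffZ K (2 * (i : ℕ) - 2 * (i' : ℕ))) = 1 := by
    rw [Matrix.det_of_isLowerTriangular]
    · refine Finset.prod_eq_one fun i _ => ?_
      rw [Matrix.of_apply, sub_self, ← Nat.cast_zero, coeffZ_natCast,
        PowerSeries.coeff_zero_eq_constantCoeff_apply, h0]
    · intro i j hij
      have h' : (i : ℕ) < j := hij
      exact coeffZ_of_neg _ (by omega)
  unfold altDet
  rw [← one_mul (Matrix.det (Matrix.of fun i j : Fin l => coeffZ G _)), ← hd, ← Matrix.det_mul]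
  congr 1
  ext i j
  rw [Matrix.mul_apply]
  simp only [Matrix.of_apply]
  rcases lt_or_ge (2 * (i : ℕ) + 1) (j : ℕ) with h | h
  · rw [coeffZ_of_neg _ (by omega)]
    symm
    refine Finset.sum_eq_zero fun k _ => ?_
    rcases lt_or_ge (i : ℕ) (k : ℕ) with h' | h'
    · rw [coeffZ_of_neg K (by omega), zero_mul]
    · rw [coeffZ_of_neg G (by omega), mul_zero]
  · obtain ⟨d, hd⟩ := Nat.exists_eq_add_of_le h
    rw [hd, show (((j : ℕ) + d : ℕ) : ℤ) - (j : ℕ) = (d : ℕ) by push_cast; ring, coeffZ_natCast,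
      mul_comm G K, PowerSeries.coeff_mul]
    symm
    have hf : ∀ k : Fin l, (k : ℕ) ≤ i → j ≤ 2 * (k : ℕ) + 1 →
        coeffZ K (2 * (i : ℕ) - 2 * (k : ℕ)) * coeffZ G (((2 * (k : ℕ) + 1 : ℕ) : ℤ) - (j : ℕ)) =
        PowerSeries.coeff (2 * (i : ℕ) - 2 * (k : ℕ)) K *
          PowerSeries.coeff (2 * (k : ℕ) + 1 - j) G := by
      intro k hk hk'
      rw [show (2 * ((i : ℕ) : ℤ) - 2 * ((k : ℕ) : ℤ)) = ((2 * (i : ℕ) - 2 * (k : ℕ) : ℕ) : ℤ) by omega,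
        show (((2 * (k : ℕ) + 1 : ℕ) : ℤ) - (j : ℕ)) = ((2 * (k : ℕ) + 1 - j : ℕ) : ℤ) by omega,
        coeffZ_natCast, coeffZ_natCast]
    have e : ∑ k ∈ Finset.univ.filter fun k : Fin l => (k : ℕ) ≤ i ∧ (j : ℕ) ≤ 2 * (k : ℕ) + 1,
        coeffZ K (2 * (i : ℕ) - 2 * (k : ℕ)) * coeffZ G (((2 * (k : ℕ) + 1 : ℕ) : ℤ) - (j : ℕ)) =
        ∑ p ∈ Finset.HasAntidiagonal.antidiagonal d, PowerSeries.coeff p.1 K * PowerSeries.coeff p.2 G := by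
      refine Finset.sum_of_injOn
        (fun k : Fin l => (2 * (i : ℕ) - 2 * (k : ℕ), 2 * (k : ℕ) + 1 - (j : ℕ))) ?_ ?_ ?_ ?_
      · intro k hk k' hk' e
        simp only [Finset.coe_filter, Finset.mem_univ, true_and, Set.mem_ofPred_eq] at hk hk'
        simp only [Prod.mk.injEq] at e
        exact Fin.ext (by omega)
      · intro k hk
        simp only [Finset.coe_filter, Finset.mem_univ, true_and, Set.mem_ofPred_eq] at hk
        simp only [Finset.mem_coe, Finset.HasAntidiagonal.mem_antidiagonal]
        omega
      · rintro ⟨x, y⟩ hxy hn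
        rw [Finset.HasAntidiagonal.mem_antidiagonal] at hxy
        simp only at hxy ⊢
        -- An even `x = 2r` comes from `k = i - r`, so only odd `x` escape the image, and there `K`
        -- vanishes.
        rcases Nat.even_or_odd x with hx | hx
        · exfalso
          obtain ⟨r, hr⟩ := hx
          apply hn
          have hr' : r ≤ i := by omega
          have hi := i.2
          refine ⟨⟨i - r, by omega⟩, ?_, ?_⟩
          · simp only [Finset.coe_filter, Finset.mem_univ, true_and, Set.mem_ofPred_eq]; omega
          · simp only [Prod.mk.injEq]; omega
        · rw [hK x hx, zero_mul]
      · intro k hk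
        simp only [Finset.mem_filter, Finset.mem_univ, true_and] at hk
        exact hf k hk.1 hk.2
    rw [← e]
    refine (Finset.sum_filter_of_ne fun k _ hne => ?_).symm
    by_contra hc
    apply hne
    rw [not_and_or, not_le, not_le] at hc
    rcases hc with hc | hc
    · rw [coeffZ_of_neg K (by omega), zero_mul]
    · rw [coeffZ_of_neg G (by omega), mul_zero]

end AltDet

/-! ### The series exp(E arctan x) and its shifts in E. -/

section ArcSeries

/-- The series `(1 + I x) ^ α (1 - I x) ^ β` with exponents in `ℂ[X]`. -/
def arcSeries (α β : ℂ[X]) : PowerSeries ℂ[X] :=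
  rescale (C Complex.I) (binomialSeries ℂ[X] α) * rescale (-C Complex.I) (binomialSeries ℂ[X] β)

theorem arcSeries_mul (α β α' β' : ℂ[X]) :
    arcSeries α β * arcSeries α' β' = arcSeries (α + α') (β + β') := by
  simp only [arcSeries, PowerSeries.binomialSeries_add, map_mul]
  ring

theorem binomialSeries_one' : binomialSeries ℂ[X] (1 : ℂ[X]) = 1 + PowerSeries.X := by
  simpa using PowerSeries.binomialSeries_nat (R := ℂ[X]) (A := ℂ[X]) 1

theorem arcSeries_one_zero :
    arcSeries 1 0 = 1 + PowerSeries.C (C Complex.I) * PowerSeries.X := by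
  rw [arcSeries, PowerSeries.binomialSeries_zero, binomialSeries_one', map_add, map_one, map_one,
    mul_one, PowerSeries.rescale_X]

theorem arcSeries_zero_one :
    arcSeries 0 1 = 1 + PowerSeries.C (-C Complex.I) * PowerSeries.X := by
  rw [arcSeries, PowerSeries.binomialSeries_zero, binomialSeries_one', map_add, map_one, map_one,
    one_mul, PowerSeries.rescale_X]

theorem arcSeries_zero_zero : arcSeries 0 0 = 1 := by
  rw [arcSeries, PowerSeries.binomialSeries_zero, map_one, map_one, one_mul]

theorem constantCoeff_arcSeries (α β : ℂ[X]) :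
    PowerSeries.constantCoeff (arcSeries α β) = 1 := by
  rw [arcSeries, map_mul, ← PowerSeries.coeff_zero_eq_constantCoeff_apply,
    ← PowerSeries.coeff_zero_eq_constantCoeff_apply, PowerSeries.coeff_rescale,
    PowerSeries.coeff_rescale]
  simp

theorem map_rescale_binomialSeries (f : ℂ[X] →ₐ[ℂ] ℂ[X]) (c : ℂ) (α : ℂ[X]) :
    (rescale (C c) (binomialSeries ℂ[X] α)).map (f : ℂ[X] →+* ℂ[X]) =
      rescale (C c) (binomialSeries ℂ[X] (f α)) := by
  have hc : f (C c) = C c := f.commutes c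
  ext1 n
  simp [hc, Ring.map_choose]

theorem map_arcSeries (f : ℂ[X] →ₐ[ℂ] ℂ[X]) (α β : ℂ[X]) :
    (arcSeries α β).map (f : ℂ[X] →+* ℂ[X]) = arcSeries (f α) (f β) := by
  rw [arcSeries, map_mul, ← C_neg, map_rescale_binomialSeries, map_rescale_binomialSeries, C_neg]
  rfl

theorem rescale_arcSeries (α β : ℂ[X]) : rescale (-1) (arcSeries α β) = arcSeries β α := by
  rw [arcSeries, map_mul, PowerSeries.rescale_rescale, PowerSeries.rescale_rescale, arcSeries,
    mul_comm]
  simp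

/-- The series is `(1 + x²)^α`, invariant under `x ↦ -x`. -/
theorem coeff_arcSeries_self (α : ℂ[X]) (n : ℕ) (hn : Odd n) :
    PowerSeries.coeff n (arcSeries α α) = 0 := by
  have h := congrArg (PowerSeries.coeff n) (rescale_arcSeries α α)
  rw [PowerSeries.coeff_rescale, hn.neg_one_pow] at h
  have : (2 : ℂ[X]) * PowerSeries.coeff n (arcSeries α α) = 0 := by linear_combination -h
  simpa using this

/-- The series `exp (E arctan x) / (1 + x ^ 2) ^ (ε / 2)`. -/
def tanSeries (ε : ℂ) : PowerSeries ℂ[X] :=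
  arcSeries (C (-Complex.I / 2) * X - C (ε / 2)) (C (Complex.I / 2) * X - C (ε / 2))

theorem constantCoeff_tanSeries (ε : ℂ) : PowerSeries.constantCoeff (tanSeries ε) = 1 :=
  constantCoeff_arcSeries _ _

theorem map_tanSeries (q : ℂ[X]) (ε : ℂ) :
    (tanSeries ε).map ((aeval q : ℂ[X] →ₐ[ℂ] ℂ[X]) : ℂ[X] →+* ℂ[X]) =
      arcSeries (C (-Complex.I / 2) * q - C (ε / 2)) (C (Complex.I / 2) * q - C (ε / 2)) := by
  rw [tanSeries, map_arcSeries]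
  simp only [map_sub, map_mul, aeval_X, aeval_C]
  rfl

theorem C_neg_half_I_mul : C (-Complex.I / 2) * C Complex.I = C (1 / 2) := by
  rw [← C_mul]
  congr 1
  linear_combination (-1 / 2 : ℂ) * Complex.I_mul_I

theorem C_half_I_mul : C (Complex.I / 2) * C Complex.I = -C (1 / 2) := by
  rw [← C_mul, ← C_neg]
  congr 1
  linear_combination (1 / 2 : ℂ) * Complex.I_mul_I

theorem C_half_add_half : (C (1 / 2) + C (1 / 2) : ℂ[X]) = 1 := by
  rw [← C_add]; norm_num

/-- As `1 + x² = (1 + Ix)(1 - Ix)`, the extra factor changes the exponents `-1/2, -1/2` into `1/2,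
-1/2`, which is the effect of `E ↦ E + I`. -/
theorem tanSeries_one_mul_add :
    tanSeries 1 * (1 + PowerSeries.C (C Complex.I) * PowerSeries.X) =
      (tanSeries 0).map ((aeval (X + C Complex.I) : ℂ[X] →ₐ[ℂ] ℂ[X]) : ℂ[X] →+* ℂ[X]) := by
  rw [← arcSeries_one_zero, map_tanSeries, tanSeries, arcSeries_mul, zero_div, C_0]
  congr 1
  · linear_combination -C_neg_half_I_mul - C_half_add_half
  · linear_combination -C_half_I_mul

theorem tanSeries_one_mul_sub :
    tanSeries 1 * (1 + PowerSeries.C (-C Complex.I) * PowerSeries.X) =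
      (tanSeries 0).map ((aeval (X - C Complex.I) : ℂ[X] →ₐ[ℂ] ℂ[X]) : ℂ[X] →+* ℂ[X]) := by
  rw [← arcSeries_zero_one, map_tanSeries, tanSeries, arcSeries_mul, zero_div, C_0]
  congr 1
  · linear_combination C_neg_half_I_mul
  · linear_combination C_half_I_mul - C_half_add_half

theorem tanSeries_zero_eval_zero :
    (tanSeries 0).map ((aeval 0 : ℂ[X] →ₐ[ℂ] ℂ[X]) : ℂ[X] →+* ℂ[X]) = 1 := by
  rw [map_tanSeries]
  simp [arcSeries_zero_zero]

theorem tanSeries_zero_neg :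
    (tanSeries 0).map ((aeval (-X) : ℂ[X] →ₐ[ℂ] ℂ[X]) : ℂ[X] →+* ℂ[X]) =
      rescale (-1) (tanSeries 0) := by
  rw [map_tanSeries, tanSeries, rescale_arcSeries]
  congr 1 <;> simp [neg_div]

/-- Changing the sign of `E` amounts to changing that of `x`. The resulting parity in `E` decides
which umbral shift rule applies. -/
theorem altDet_tanSeries_zero_neg {l : ℕ} (ν : Fin l → ℕ) :
    aeval (-X) (altDet (tanSeries 0) fun i => (ν i : ℤ)) =
      (-1) ^ (∑ i : Fin l, (i : ℕ) + ∑ i, ν i) * altDet (tanSeries 0) fun i => (ν i : ℤ) := by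
  have h := altDet_rescale (-1) (tanSeries 0) ν
  rw [← tanSeries_zero_neg, altDet_map] at h
  have h1 : ((-1 : ℂ[X]) ^ (∑ i : Fin l, (i : ℕ))) * (-1) ^ (∑ i : Fin l, (i : ℕ)) = 1 := by
    rw [← mul_pow]; simp
  rw [pow_add, mul_assoc, ← h]
  simp only [RingHom.coe_coe]
  linear_combination (-(aeval (-X) (altDet (tanSeries 0) fun i => (ν i : ℤ)) : ℂ[X])) * h1

end ArcSeries

/-! ### Umbral shift rules and the recurrence for the determinants. -/

section Umbral

theorem I_pow_add_neg_I_pow_of_odd {k : ℕ} (h : Odd k) :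
    Complex.I ^ k + (-Complex.I) ^ k = 0 := by
  rw [h.neg_pow, add_neg_cancel]

theorem I_pow_sub_neg_I_pow_of_even {k : ℕ} (h : Even k) :
    Complex.I ^ k - (-Complex.I) ^ k = 0 := by
  rw [h.neg_pow, sub_self]

/-- For `k = 2r > 0` the floor `(k - 1) / 2` is `r - 1`; this lets even and odd sizes share one sign
formula. -/
theorem I_pow_add_neg_I_pow_of_even {k : ℕ} (h : Even k) (h0 : k ≠ 0) :
    Complex.I ^ k + (-Complex.I) ^ k = -2 * (-1) ^ ((k - 1) / 2) := by
  obtain ⟨r, rfl⟩ := h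
  obtain ⟨r, rfl⟩ : ∃ s, r = s + 1 := ⟨r - 1, by omega⟩
  rw [Even.neg_pow ⟨_, rfl⟩, show (r + 1 + (r + 1) - 1) / 2 = r by omega,
    show r + 1 + (r + 1) = 2 * (r + 1) by omega, pow_mul, Complex.I_sq, pow_succ]
  ring

theorem I_pow_sub_neg_I_pow_of_odd {k : ℕ} (h : Odd k) :
    Complex.I ^ k - (-Complex.I) ^ k = 2 * Complex.I * (-1) ^ ((k - 1) / 2) := by
  rw [h.neg_pow]
  obtain ⟨r, rfl⟩ := h
  rw [show (2 * r + 1 - 1) / 2 = r by omega, pow_succ, pow_mul, Complex.I_sq]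
  ring

theorem sum_I_pow_add {l : ℕ} (φ : Finset (Fin l) → ℂ) :
    ∑ B : Finset (Fin l), Complex.I ^ B.card * φ B +
      ∑ B : Finset (Fin l), (-Complex.I) ^ B.card * φ B =
    2 * (φ ∅ - ∑ B : Finset (Fin l) with B.Nonempty ∧ Even B.card,
      (-1) ^ ((B.card - 1) / 2) * φ B) := by
  rw [← Finset.sum_add_distrib, Finset.sum_filter, mul_sub, Finset.mul_sum,
    ← Finset.add_sum_erase _ _ (Finset.mem_univ ∅),
    ← Finset.add_sum_erase Finset.univ (fun B : Finset (Fin l) => 2 * _) (Finset.mem_univ ∅)]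
  simp only [Finset.card_empty, pow_zero, Finset.not_nonempty_empty, false_and, if_false,
    mul_zero, zero_add]
  rw [sub_eq_add_neg, ← Finset.sum_neg_distrib]
  congr 1
  · ring
  refine Finset.sum_congr rfl fun B hB => ?_
  have hne : B.Nonempty := Finset.nonempty_iff_ne_empty.mpr (Finset.ne_of_mem_erase hB)
  rcases Nat.even_or_odd B.card with h | h
  · rw [if_pos ⟨hne, h⟩, ← add_mul, I_pow_add_neg_I_pow_of_even h hne.card_pos.ne']
    ring
  · rw [if_neg fun c => (Nat.not_even_iff_odd.mpr h) c.2, ← add_mul,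
      I_pow_add_neg_I_pow_of_odd h]
    ring

theorem sum_I_pow_sub {l : ℕ} (φ : Finset (Fin l) → ℂ) :
    ∑ B : Finset (Fin l), Complex.I ^ B.card * φ B -
      ∑ B : Finset (Fin l), (-Complex.I) ^ B.card * φ B =
    2 * Complex.I * ∑ B : Finset (Fin l) with Odd B.card, (-1) ^ ((B.card - 1) / 2) * φ B := by
  rw [← Finset.sum_sub_distrib, Finset.sum_filter, Finset.mul_sum]
  refine Finset.sum_congr rfl fun B _ => ?_
  rcases Nat.even_or_odd B.card with h | h
  · rw [if_neg (Nat.not_odd_iff_even.mpr h), ← sub_mul, I_pow_sub_neg_I_pow_of_even h]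
    ring
  · rw [if_pos h, ← sub_mul, I_pow_sub_neg_I_pow_of_odd h]
    ring

/-- The nonempty sets whose cardinality has the parity of `n`. -/
def blocks (l n : ℕ) : Finset (Finset (Fin l)) :=
  Finset.univ.filter fun B => B.Nonempty ∧ Even (n + B.card)

theorem blocks_of_even {l n : ℕ} (h : Even n) :
    blocks l n = Finset.univ.filter fun B : Finset (Fin l) => B.Nonempty ∧ Even B.card := by
  ext B
  simp [blocks, Nat.even_add, h]

theorem blocks_of_odd {l n : ℕ} (h : Odd n) :
    blocks l n = Finset.univ.filter fun B : Finset (Fin l) => Odd B.card := by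
  ext B
  simp only [blocks, Finset.mem_filter, Finset.mem_univ, true_and, Nat.even_add,
    Nat.not_even_iff_odd.mpr h, false_iff, Nat.not_even_iff_odd]
  exact ⟨fun c => c.2, fun c => ⟨Finset.card_pos.mp c.pos, c⟩⟩

/-- The recurrence satisfied by the Euler numbers. -/
def EulerRecurrence (e : ℕ → ℂ) : Prop :=
  e 0 = 1 ∧ ∀ n, n ≠ 0 →
    e n = ∑ B ∈ blocks n n, (-1) ^ ((B.card - 1) / 2) * e (n - B.card)

/-- The linear functional on polynomials sending `X ^ n` to `e n`. -/
def umbralMap (e : ℕ → ℂ) : ℂ[X] →ₗ[ℂ] ℂ :=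
  Polynomial.lsum fun n => LinearMap.mulRight ℂ (e n)

theorem umbralMap_apply (e : ℕ → ℂ) (p : ℂ[X]) : umbralMap e p = p.sum fun n a => a * e n := rfl

theorem umbralMap_C_mul (e : ℕ → ℂ) (c : ℂ) (p : ℂ[X]) :
    umbralMap e (C c * p) = c * umbralMap e p := by
  rw [← smul_eq_C_mul, map_smul, smul_eq_mul]

theorem umbralMap_X_pow (e : ℕ → ℂ) (n : ℕ) : umbralMap e (X ^ n) = e n := by
  rw [umbralMap_apply, X_pow_eq_monomial, sum_monomial_index _ _ (by simp), one_mul]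

/-- The binomial theorem is summed over sets rather than sizes, to match `blocks n n` in
`EulerRecurrence`. -/
theorem umbralMap_add_pow (e : ℕ → ℂ) (z : ℂ) (n : ℕ) :
    umbralMap e ((X + C z) ^ n) = ∑ B : Finset (Fin n), z ^ B.card * e (n - B.card) := by
  rw [add_comm, ← Fin.sum_pow_mul_eq_add_pow, map_sum]
  refine Finset.sum_congr rfl fun B _ => ?_
  rw [← C_pow, umbralMap_C_mul, umbralMap_X_pow]

variable {e : ℕ → ℂ}

theorem umbralMap_shift_X_pow_of_even (he : EulerRecurrence e) {n : ℕ} (hn : Even n) :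
    umbralMap e ((X + C Complex.I) ^ n) + umbralMap e ((X - C Complex.I) ^ n) =
      2 * umbralMap e (0 ^ n) := by
  rw [sub_eq_add_neg, ← C_neg, umbralMap_add_pow, umbralMap_add_pow,
    sum_I_pow_add fun B => e (n - B.card)]
  congr 1
  rcases eq_or_ne n 0 with rfl | h0
  · rw [Finset.sum_eq_zero, Finset.card_empty, sub_zero, pow_zero, ← pow_zero X, umbralMap_X_pow]
    intro B hB
    rw [Finset.mem_filter] at hB
    obtain ⟨i, -⟩ := hB.2.1
    exact i.elim0
  · rw [← blocks_of_even hn, Finset.card_empty, Nat.sub_zero, ← he.2 n h0, sub_self, zero_pow h0,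
      map_zero]

theorem umbralMap_shift_X_pow_of_odd (he : EulerRecurrence e) {n : ℕ} (hn : Odd n) :
    umbralMap e ((X + C Complex.I) ^ n) - umbralMap e ((X - C Complex.I) ^ n) =
      2 * Complex.I * umbralMap e (X ^ n) := by
  rw [sub_eq_add_neg X, ← C_neg, umbralMap_add_pow, umbralMap_add_pow,
    sum_I_pow_sub fun B => e (n - B.card), umbralMap_X_pow, ← blocks_of_odd hn, ← he.2 n hn.pos.ne']

theorem umbralMap_shift_of_even (he : EulerRecurrence e) {p : ℂ[X]} (hp : aeval (-X) p = p) :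
    umbralMap e (aeval (X + C Complex.I) p) + umbralMap e (aeval (X - C Complex.I) p) =
      2 * umbralMap e (aeval 0 p) := by
  let T (q : ℂ[X]) : ℂ[X] →ₗ[ℂ] ℂ := umbralMap e ∘ₗ (aeval q : ℂ[X] →ₐ[ℂ] ℂ[X]).toLinearMap
  -- After composition with `q ↦ q(X) + q(-X)` the identity holds for every polynomial, so monomials
  -- suffice; the odd ones are killed.
  have key : (T (X + C Complex.I) + T (X - C Complex.I) - (2 : ℂ) • T 0) ∘ₗ
      (LinearMap.id + (aeval (-X) : ℂ[X] →ₐ[ℂ] ℂ[X]).toLinearMap) = 0 := by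
    refine Polynomial.lhom_ext' fun n => LinearMap.ext_ring ?_
    simp only [LinearMap.comp_apply, LinearMap.zero_apply, ← X_pow_eq_monomial,
      LinearMap.add_apply, LinearMap.id_apply, AlgHom.toLinearMap_apply, map_pow, aeval_X]
    rcases Nat.even_or_odd n with h | h
    · rw [h.neg_pow, ← two_mul, ← C_ofNat, ← smul_eq_C_mul, map_smul]
      simp only [T, LinearMap.sub_apply, LinearMap.add_apply, LinearMap.smul_apply,
        LinearMap.comp_apply, AlgHom.toLinearMap_apply, map_pow, aeval_X]
      rw [umbralMap_shift_X_pow_of_even he h, smul_eq_mul, smul_eq_mul, sub_self, mul_zero]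
    · rw [h.neg_pow, add_neg_cancel, map_zero]
  have h := LinearMap.congr_fun key p
  simp only [LinearMap.comp_apply, LinearMap.zero_apply,
      LinearMap.add_apply, LinearMap.id_apply, AlgHom.toLinearMap_apply, hp, T,
      LinearMap.sub_apply, LinearMap.smul_apply, map_add, smul_eq_mul] at h
  linear_combination h / 2

theorem umbralMap_shift_of_odd (he : EulerRecurrence e) {p : ℂ[X]} (hp : aeval (-X) p = -p) :
    umbralMap e (aeval (X + C Complex.I) p) - umbralMap e (aeval (X - C Complex.I) p) =
      2 * Complex.I * umbralMap e p := by
  let T (q : ℂ[X]) : ℂ[X] →ₗ[ℂ] ℂ := umbralMap e ∘ₗ (aeval q : ℂ[X] →ₐ[ℂ] ℂ[X]).toLinearMap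
  have key : (T (X + C Complex.I) - T (X - C Complex.I) - (2 * Complex.I) • umbralMap e) ∘ₗ
      (LinearMap.id - (aeval (-X) : ℂ[X] →ₐ[ℂ] ℂ[X]).toLinearMap) = 0 := by
    refine Polynomial.lhom_ext' fun n => LinearMap.ext_ring ?_
    simp only [LinearMap.comp_apply, LinearMap.zero_apply, ← X_pow_eq_monomial,
      LinearMap.sub_apply, LinearMap.id_apply, AlgHom.toLinearMap_apply, map_pow, aeval_X]
    rcases Nat.even_or_odd n with h | h
    · rw [h.neg_pow, sub_self, map_zero, map_zero, map_zero]
      simp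
    · rw [h.neg_pow, sub_neg_eq_add, ← two_mul, ← C_ofNat, ← smul_eq_C_mul]
      simp only [T, LinearMap.smul_apply, map_smul,
        LinearMap.comp_apply, AlgHom.toLinearMap_apply, map_pow, aeval_X]
      have := umbralMap_shift_X_pow_of_odd he h
      simp only [smul_eq_mul]
      linear_combination 2 * this
  have h := LinearMap.congr_fun key p
  simp only [LinearMap.comp_apply, LinearMap.zero_apply,
      LinearMap.sub_apply, LinearMap.id_apply, AlgHom.toLinearMap_apply, hp, T,
      LinearMap.smul_apply, map_neg, map_sub, smul_eq_mul] at h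
  linear_combination h / 2

/-- The value predicted for the number of alternating tableaux with row lengths `a`. -/
def altValue (e : ℕ → ℂ) (n : ℕ) {l : ℕ} (a : Fin l → ℤ) : ℂ :=
  umbralMap e (altDet (tanSeries (if Even n then 1 else 0)) fun i => a i + (i : ℕ))

/-- Intended for `b = a - 1_B` with `a` a partition. A failure of monotonicity is a drop by one
between neighbours, and adding `i` then makes two rows equal; otherwise `b 0 < 0` and the first row
vanishes. Such contents also count no words. -/
theorem altDet_shift_eq_zero (G : PowerSeries ℂ[X]) {l : ℕ} {b : Fin l → ℤ}
    (h1 : ∀ i j, i ≤ j → b i ≤ b j + 1) (h2 : ∀ i, -1 ≤ b i)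
    (h : ¬ (Monotone b ∧ ∀ i, 0 ≤ b i)) : altDet G (fun i => b i + (i : ℕ)) = 0 := by
  cases l with
  | zero => exact absurd ⟨fun i => i.elim0, fun i => i.elim0⟩ h
  | succ l =>
    by_cases hm : Monotone b
    · have h0 : b 0 < 0 := by
        by_contra hc
        exact h ⟨hm, fun i => (not_lt.mp hc).trans (hm (Fin.zero_le i))⟩
      exact altDet_eq_zero_of_row G 0 (by simpa using h0)
    · rw [Fin.monotone_iff_le_succ] at hm
      push Not at hm
      obtain ⟨i, hi⟩ := hm
      have := h1 i.castSucc i.succ i.castSucc_lt_succ.le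
      refine altDet_eq_zero_of_eq G (i := i.castSucc) (j := i.succ) i.castSucc_lt_succ.ne ?_
      simp only [Fin.val_castSucc, Fin.val_succ]
      push_cast
      omega

/-- Since `n - |B|` is even on `blocks`, every term on the right uses `tanSeries 1`. The left side
is the term `B = ∅` of the same expansion when `n` is even, and the value of the unshifted `p` when
`n` is odd. -/
theorem altValue_recurrence (he : EulerRecurrence e) {l n : ℕ} (hn : n ≠ 0) {a : Fin l → ℤ}
    (ha : Monotone a) (h0 : ∀ i, 0 ≤ a i) (hs : ∑ i, a i = n) :
    altValue e n a = ∑ B ∈ blocks l n, (-1) ^ ((B.card - 1) / 2) *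
      altValue e (n - B.card) (fun i => a i - if i ∈ B then 1 else 0) := by
  have h1 : ∀ B ∈ blocks l n,
      altValue e (n - B.card) (fun i => a i - if i ∈ B then 1 else 0) =
      umbralMap e (altDet (tanSeries 1) fun i => (a i + (i : ℕ)) - if i ∈ B then 1 else 0) := by
    intro B hB
    have : Even (n - B.card) := by
      simp only [blocks, Finset.mem_filter, Finset.mem_univ, true_and] at hB
      rcases le_or_gt B.card n with h | h
      · rw [Nat.even_sub h, ← Nat.even_add]; exact hB.2
      -- For `|B| > n` the difference truncates to zero, which still selects `tanSeries 1`.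
      · rw [Nat.sub_eq_zero_of_le h.le]; exact Even.zero
    rw [altValue, if_pos this]
    congr 2
    ext i
    ring
  rw [Finset.sum_congr rfl fun B hB => by rw [h1 B hB]]
  have hadd (z : ℂ) :
      umbralMap e (altDet (tanSeries 1 * (1 + PowerSeries.C (C z) * PowerSeries.X))
        fun i => a i + (i : ℕ)) = ∑ B : Finset (Fin l), z ^ B.card *
      umbralMap e (altDet (tanSeries 1) fun i => (a i + (i : ℕ)) - if i ∈ B then 1 else 0) := by
    rw [altDet_mul_one_add, map_sum]
    refine Finset.sum_congr rfl fun B _ => ?_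
    rw [← C_pow, umbralMap_C_mul]
  have hI := hadd Complex.I
  have hI' := hadd (-Complex.I)
  rw [tanSeries_one_mul_add, altDet_map] at hI
  rw [C_neg, tanSeries_one_mul_sub, altDet_map] at hI'
  set p := altDet (tanSeries 0) fun i : Fin l => a i + (i : ℕ) with hp
  have hpar : aeval (-X) p = (-1) ^ n * p := by
    have hν : (fun i : Fin l => a i + (i : ℕ)) = fun i => (((a i).toNat + (i : ℕ) : ℕ) : ℤ) := by
      ext i
      have := h0 i
      push_cast
      omega
    have hN : ∑ i, (a i).toNat = n := by
      zify
      rw [← hs]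
      exact Finset.sum_congr rfl fun i _ => Int.toNat_of_nonneg (h0 i)
    rw [hp, hν, altDet_tanSeries_zero_neg]
    congr 1
    rw [Finset.sum_add_distrib, hN, add_comm, add_assoc, pow_add, ← two_mul, pow_mul]
    simp
  rcases Nat.even_or_odd n with h | h
  · rw [h.neg_one_pow, one_mul] at hpar
    have key := umbralMap_shift_of_even he hpar
    simp only [RingHom.coe_coe] at hI hI'
    rw [hI, hI', sum_I_pow_add] at key
    -- At `E = 0` the series is 1. The largest part of `a` is positive because `n ≠ 0`, so the last
    -- row has index at least `l` and vanishes.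
    have hz : (aeval 0 p : ℂ[X]) = 0 := by
      have e0 := altDet_map ((aeval 0 : ℂ[X] →ₐ[ℂ] ℂ[X]) : ℂ[X] →+* ℂ[X]) (tanSeries 0)
        fun i : Fin l => a i + (i : ℕ)
      rw [tanSeries_zero_eval_zero] at e0
      simp only [RingHom.coe_coe] at e0
      rw [hp, ← e0]
      have hl : l ≠ 0 := by
        rintro rfl
        apply hn
        have : (0 : ℤ) = n := by simpa using hs
        exact_mod_cast this.symm
      have hlast : 0 < a ⟨l - 1, by omega⟩ := by
        by_contra hc
        have : ∑ i, a i = 0 := Finset.sum_eq_zero fun i _ =>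
          le_antisymm ((ha (by rw [Fin.le_def]; have := i.2; simp only; omega)).trans
            (not_lt.mp hc)) (h0 i)
        omega
      exact altDet_one_eq_zero ⟨l - 1, by omega⟩ (by simp only; omega)
    rw [hz, map_zero, ← blocks_of_even h] at key
    rw [altValue, if_pos h]
    simp only [Finset.notMem_empty, if_false, sub_zero] at key
    linear_combination key / 2
  · rw [h.neg_one_pow, neg_one_mul] at hpar
    have key := umbralMap_shift_of_odd he hpar
    simp only [RingHom.coe_coe] at hI hI'
    rw [hI, hI', sum_I_pow_sub, ← blocks_of_odd h] at key
    rw [altValue, if_neg (Nat.not_even_iff_odd.mpr h)]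
    exact (mul_left_cancel₀ (by simp) key).symm

theorem altValue_zero (he : EulerRecurrence e) {l : ℕ} : altValue e 0 (fun _ : Fin l => 0) = 1 := by
  simp only [altValue, zero_add]
  rw [altDet_id (constantCoeff_tanSeries _), ← pow_zero X, umbralMap_X_pow, he.1]

end Umbral

/-! ### Alternating words counted by inclusion–exclusion. -/

section Words

/-- The number of occurrences of each letter among the first `k` letters of a word. -/
def prefixContent {n l : ℕ} (w : Fin n → Fin l) (k : ℕ) : Fin l → ℤ :=
  fun i => ((Finset.univ.filter fun x : Fin n => (x : ℕ) < k ∧ w x = i).card : ℤ)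

/-- The descent set of a word, with 1-based positions. -/
def wordDescentSet {n l : ℕ} (w : Fin n → Fin l) : Set ℕ :=
  {i | ∃ a b : Fin n, (a : ℕ) + 1 = i ∧ (b : ℕ) = i ∧ w b < w a}

/-- Words of length `n` and content `a` all of whose prefixes have content in `S`. -/
def IsPath {n l : ℕ} (S : Set (Fin l → ℤ)) (a : Fin l → ℤ) (w : Fin n → Fin l) : Prop :=
  prefixContent w n = a ∧ ∀ k, prefixContent w k ∈ S

/-- The number of alternating words of length `n` and content `a` all of whose prefixes have content
in `S`. -/
def altCount {l : ℕ} (S : Set (Fin l → ℤ)) (n : ℕ) (a : Fin l → ℤ) : ℕ :=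
  Nat.card {w : Fin n → Fin l // IsPath S a w ∧ wordDescentSet w = {i | Odd i} ∩ Set.Ico 1 n}

theorem wordDescentSet_subset {n l : ℕ} (w : Fin n → Fin l) :
    wordDescentSet w ⊆ Set.Ico 1 n := by
  rintro i ⟨a, b, ha, hb, -⟩
  have := b.2
  simp only [Set.mem_Ico]
  omega

theorem prefixContent_of_le {n l : ℕ} (w : Fin n → Fin l) {k : ℕ} (h : n ≤ k) :
    prefixContent w k = prefixContent w n := by
  ext i
  simp only [prefixContent]
  congr 2
  ext x
  have := x.2
  simp only [Finset.mem_filter, Finset.mem_univ, true_and]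
  constructor <;> rintro ⟨-, h'⟩ <;> exact ⟨by omega, h'⟩

theorem sum_prefixContent {n l : ℕ} (w : Fin n → Fin l) : ∑ i, prefixContent w n i = n := by
  simp only [prefixContent, Fin.is_lt, true_and]
  rw [← Nat.cast_sum, ← Finset.card_eq_sum_card_fiberwise fun x _ => Finset.mem_univ (w x)]
  simp

/-- The set `D` agrees with the odd numbers below `p` and contains all numbers strictly between `p`
and `n`. -/
def IsBlockDescent (p n : ℕ) (D : Set ℕ) : Prop :=
  (∀ i, 0 < i → i < p → (i ∈ D ↔ Odd i)) ∧ ∀ i, p < i → i < n → i ∈ D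

-- `IsBlockDescent (2 * t)` leaves the position `2t` free. If `2t` is a descent with `t > 0`, the
-- set is of block type already from `2t - 2`, which is then not a descent; hence the alternating
-- sum telescopes.
open Classical in
theorem indicator_block (D : Set ℕ) (h0 : 0 ∉ D) {n s : ℕ} (hs : 2 * s < n) :
    (if IsBlockDescent (2 * s) n D ∧ 2 * s ∉ D then (1 : ℤ) else 0) =
      ∑ t ∈ Finset.range (s + 1),
        (-1) ^ (s - t) * (if IsBlockDescent (2 * t) n D then 1 else 0) := by
  induction s with
  | zero => rw [Finset.sum_range_one]; simp [h0]
  | succ s ih =>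
    have hstep : (IsBlockDescent (2 * (s + 1)) n D ∧ 2 * (s + 1) ∈ D) ↔
        (IsBlockDescent (2 * s) n D ∧ 2 * s ∉ D) := by
      constructor
      · rintro ⟨⟨h1, h2⟩, h3⟩
        refine ⟨⟨fun i hi hi' => h1 i hi (by omega), fun i hi hi' => ?_⟩, fun h => ?_⟩
        · rcases lt_trichotomy i (2 * (s + 1)) with h | h | h
          · exact (h1 i (by omega) h).mpr ⟨s, by omega⟩
          · rwa [h]
          · exact h2 i h hi'
        · rcases Nat.eq_zero_or_pos s with rfl | hs'
          · exact h0 h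
          · have := (h1 (2 * s) (by omega) (by omega)).mp h
            exact Nat.not_odd_iff_even.mpr ⟨s, by omega⟩ this
      · rintro ⟨⟨h1, h2⟩, h3⟩
        refine ⟨⟨fun i hi hi' => ?_, fun i hi hi' => h2 i (by omega) hi'⟩, h2 _ (by omega) hs⟩
        rcases lt_trichotomy i (2 * s) with h | h | h
        · exact h1 i hi h
        · rw [h]
          exact ⟨fun c => absurd c h3, fun c => absurd c (Nat.not_odd_iff_even.mpr ⟨s, by omega⟩)⟩
        · exact ⟨fun _ => ⟨s, by omega⟩, fun _ => h2 i h (by omega)⟩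
    rw [Finset.sum_range_succ, Nat.sub_self, pow_zero, one_mul]
    have : ∑ t ∈ Finset.range (s + 1),
        (-1 : ℤ) ^ (s + 1 - t) * (if IsBlockDescent (2 * t) n D then 1 else 0) =
        -(if IsBlockDescent (2 * s) n D ∧ 2 * s ∉ D then 1 else 0) := by
      rw [ih (by omega), ← Finset.sum_neg_distrib]
      refine Finset.sum_congr rfl fun t ht => ?_
      rw [Nat.succ_sub (by rw [Finset.mem_range] at ht; omega), pow_succ]
      ring
    rw [this, ← if_congr hstep rfl rfl]
    by_cases h1 : IsBlockDescent (2 * (s + 1)) n D <;> by_cases h2 : 2 * (s + 1) ∈ D <;>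
      simp [h1, h2]

theorem eq_odd_inter_iff {D : Set ℕ} {n : ℕ} (hD : D ⊆ Set.Ico 1 n) :
    D = {i | Odd i} ∩ Set.Ico 1 n ↔
      IsBlockDescent (2 * ((n - 1) / 2)) n D ∧ 2 * ((n - 1) / 2) ∉ D := by
  constructor
  · rintro rfl
    refine ⟨⟨fun i hi hi' => ⟨fun h => h.1, fun h => ⟨h, hi, by omega⟩⟩, fun i hi hi' =>
      ⟨⟨(n - 1) / 2, by omega⟩, by omega, hi'⟩⟩, fun h => ?_⟩
    exact Nat.not_odd_iff_even.mpr ⟨(n - 1) / 2, by omega⟩ h.1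
  · rintro ⟨⟨h1, h2⟩, h3⟩
    ext i
    constructor
    · intro hi
      have hi' := hD hi
      refine ⟨?_, hi'⟩
      rcases lt_trichotomy i (2 * ((n - 1) / 2)) with h | h | h
      · exact (h1 i hi'.1 h).mp hi
      · exact absurd (h ▸ hi) h3
      · have := hi'.2
        exact ⟨(n - 1) / 2, by omega⟩
    · rintro ⟨ho, hi, hi'⟩
      rcases lt_trichotomy i (2 * ((n - 1) / 2)) with h | h | h
      · exact (h1 i hi h).mpr ho
      · exact absurd ho (Nat.not_odd_iff_even.mpr ⟨(n - 1) / 2, by omega⟩)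
      · exact h2 i h hi'

/-- The strictly decreasing enumeration of a finite set of letters. -/
def decreasingWord {l q : ℕ} (B : Finset (Fin l)) (h : B.card = q) : Fin q → Fin l :=
  fun x => B.orderEmbOfFin h x.rev

theorem decreasingWord_strictAnti {l q : ℕ} (B : Finset (Fin l)) (h : B.card = q) :
    StrictAnti (decreasingWord B h) :=
  fun _ _ hxy => (B.orderEmbOfFin h).strictMono (Fin.rev_lt_rev.mpr hxy)

theorem image_decreasingWord {l q : ℕ} (B : Finset (Fin l)) (h : B.card = q) :
    Finset.univ.image (decreasingWord B h) = B := by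
  ext i
  have hr := Finset.range_orderEmbOfFin B h
  constructor
  · intro hi
    obtain ⟨x, -, rfl⟩ := Finset.mem_image.mp hi
    exact Finset.orderEmbOfFin_mem B h _
  · intro hi
    have : i ∈ Set.range (B.orderEmbOfFin h) := by rw [hr]; exact hi
    obtain ⟨x, rfl⟩ := this
    exact Finset.mem_image.mpr ⟨x.rev, Finset.mem_univ _, by simp [decreasingWord]⟩

theorem eq_decreasingWord {l q : ℕ} {v : Fin q → Fin l} (hv : StrictAnti v) {B : Finset (Fin l)}
    (h : B.card = q) (hB : Finset.univ.image v = B) : v = decreasingWord B h := by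
  have h1 : (fun x : Fin q => v x.rev) = B.orderEmbOfFin h := by
    refine Finset.orderEmbOfFin_unique h (fun x => ?_) fun x y hxy => hv (Fin.rev_lt_rev.mpr hxy)
    rw [← hB]
    exact Finset.mem_image_of_mem _ (Finset.mem_univ _)
  ext x
  have := congrFun h1 x.rev
  simp only [Fin.rev_rev] at this
  rw [this, decreasingWord]

theorem prefixContent_append {p q l : ℕ} (u : Fin p → Fin l) (v : Fin q → Fin l) (k : ℕ) :
    prefixContent (Fin.append u v) k = prefixContent u k + prefixContent v (k - p) := by
  ext i
  simp only [prefixContent, Pi.add_apply, Finset.card_filter, Fin.sum_univ_add, Fin.append_left,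
    Fin.append_right, Fin.val_castAdd, Fin.val_natAdd]
  push_cast
  congr 1
  refine Finset.sum_congr rfl fun x _ => ?_
  exact if_congr (and_congr_left fun _ => by omega) rfl rfl

theorem prefixContent_of_strictAnti {q l : ℕ} {v : Fin q → Fin l} (hv : StrictAnti v) (k : ℕ) :
    prefixContent v k = fun i =>
      if i ∈ (Finset.univ.filter fun x : Fin q => (x : ℕ) < k).image v then 1 else 0 := by
  ext i
  simp only [prefixContent, Finset.mem_image, Finset.mem_filter, Finset.mem_univ, true_and]
  split_ifs with h
  · obtain ⟨x, hx, rfl⟩ := h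
    have : (Finset.univ.filter fun y : Fin q => (y : ℕ) < k ∧ v y = v x) = {x} := by
      ext y
      simp only [Finset.mem_filter, Finset.mem_univ, true_and, Finset.mem_singleton]
      exact ⟨fun h => hv.injective h.2, by rintro rfl; exact ⟨hx, rfl⟩⟩
    rw [this]; simp
  · rw [Finset.filter_eq_empty_iff.mpr fun x _ hx => h ⟨x, hx.1, hx.2⟩]; simp

/-- `S` is closed under adding the largest letters of a set first. -/
def IsStripClosed {l : ℕ} (S : Set (Fin l → ℤ)) : Prop :=
  ∀ (a : Fin l → ℤ) (B U : Finset (Fin l)), U ⊆ B → (∀ x ∈ U, ∀ y ∈ B, x ≤ y → y ∈ U) → a ∈ S →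
    (fun i => a i + if i ∈ B then 1 else 0) ∈ S → (fun i => a i + if i ∈ U then 1 else 0) ∈ S

/-- A decreasing block adds the letters of `B` from the largest down. Its intermediate contents add
an upper part of `B`, so `IsStripClosed` puts them in `S` as soon as both ends are there. -/
theorem isPath_append_iff {p q l : ℕ} {S : Set (Fin l → ℤ)} (hS : IsStripClosed S)
    {a : Fin l → ℤ} (ha : a ∈ S) (u : Fin p → Fin l) (B : Finset (Fin l)) (h : B.card = q) :
    IsPath S a (Fin.append u (decreasingWord B h)) ↔
      IsPath S (fun i => a i - if i ∈ B then 1 else 0) u := by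
  have hv := decreasingWord_strictAnti B h
  have hfull : prefixContent (decreasingWord B h) q = fun i => if i ∈ B then 1 else 0 := by
    rw [prefixContent_of_strictAnti hv]
    simp only [Fin.is_lt, Finset.filter_true, image_decreasingWord]
  have hend : prefixContent (Fin.append u (decreasingWord B h)) (p + q) =
      fun i => prefixContent u p i + if i ∈ B then 1 else 0 := by
    rw [prefixContent_append, Nat.add_sub_cancel_left, hfull,
      prefixContent_of_le u (Nat.le_add_right p q)]
    rfl
  have hiff : prefixContent (Fin.append u (decreasingWord B h)) (p + q) = a ↔
      prefixContent u p = fun i => a i - if i ∈ B then 1 else 0 := by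
    rw [hend, funext_iff, funext_iff]
    exact forall_congr' fun i => by constructor <;> intro h <;> linarith
  unfold IsPath
  rw [hiff]
  refine and_congr_right fun hp => ⟨fun hk k => ?_, fun hk k => ?_⟩
  · have := hk (min k p)
    rw [prefixContent_append, Nat.sub_eq_zero_of_le (min_le_right k p)] at this
    have h0 : prefixContent (decreasingWord B h) 0 = 0 := by ext i; simp [prefixContent]
    rw [h0, add_zero] at this
    rcases le_total k p with hkp | hkp
    · rwa [min_eq_left hkp] at this
    · rwa [min_eq_right hkp, ← prefixContent_of_le u hkp] at this
  · rw [prefixContent_append]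
    rcases le_total k p with hkp | hkp
    · have h0 : prefixContent (decreasingWord B h) 0 = 0 := by ext i; simp [prefixContent]
      rw [Nat.sub_eq_zero_of_le hkp, h0, add_zero]
      exact hk k
    · rw [prefixContent_of_le u hkp, prefixContent_of_strictAnti hv]
      refine hS _ B _ ?_ ?_ (hk p) ?_
      · conv_rhs => rw [← image_decreasingWord B h]
        exact Finset.image_subset_image (Finset.filter_subset _ _)
      · intro x hx y hy hxy
        obtain ⟨x', hx', rfl⟩ := Finset.mem_image.mp hx
        rw [← image_decreasingWord B h] at hy
        obtain ⟨y', -, rfl⟩ := Finset.mem_image.mp hy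
        have hle : y' ≤ x' := hv.le_iff_ge.mp hxy
        simp only [Finset.mem_filter, Finset.mem_univ, true_and] at hx'
        refine Finset.mem_image_of_mem _ ?_
        simp only [Finset.mem_filter, Finset.mem_univ, true_and]
        exact lt_of_le_of_lt hle hx'
      · rw [hp]
        simpa using ha

/-- The comparison across the join is at position `p`, which `IsBlockDescent` leaves free; so the
two halves are independent. -/
theorem isBlockDescent_append_iff {p q l : ℕ} (u : Fin p → Fin l) (v : Fin q → Fin l) :
    IsBlockDescent p (p + q) (wordDescentSet (Fin.append u v)) ↔
      wordDescentSet u = {i | Odd i} ∩ Set.Ico 1 p ∧ StrictAnti v := by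
  have h1 : ∀ i, i < p → (i ∈ wordDescentSet (Fin.append u v) ↔ i ∈ wordDescentSet u) := by
    intro i hi
    constructor
    · rintro ⟨a, b, ha, hb, hab⟩
      refine ⟨⟨a, by omega⟩, ⟨b, by omega⟩, ha, hb, ?_⟩
      rw [← Fin.append_left u v, ← Fin.append_left u v]
      exact hab
    · rintro ⟨a, b, ha, hb, hab⟩
      refine ⟨Fin.castAdd q a, Fin.castAdd q b, ha, hb, ?_⟩
      rwa [Fin.append_left, Fin.append_left]
  have h2 : ∀ (x y : Fin q), (x : ℕ) + 1 = y →
      (p + (y : ℕ) ∈ wordDescentSet (Fin.append u v) ↔ v y < v x) := by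
    intro x y hxy
    constructor
    · rintro ⟨a, b, ha, hb, hab⟩
      have ea : a = Fin.natAdd p x := Fin.ext (by rw [Fin.val_natAdd]; omega)
      have eb : b = Fin.natAdd p y := Fin.ext (by rw [Fin.val_natAdd]; omega)
      rwa [ea, eb, Fin.append_right, Fin.append_right] at hab
    · intro h
      refine ⟨Fin.natAdd p x, Fin.natAdd p y, by rw [Fin.val_natAdd]; omega, by simp, ?_⟩
      rwa [Fin.append_right, Fin.append_right]
  refine and_congr ⟨fun h => ?_, fun h i hi hi' => ?_⟩ ⟨fun h => ?_, fun h i hi hi' => ?_⟩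
  · ext i
    constructor
    · intro hi
      have hi' := wordDescentSet_subset u hi
      exact ⟨(h i hi'.1 hi'.2).mp ((h1 i hi'.2).mpr hi), hi'⟩
    · rintro ⟨ho, hi, hi'⟩
      exact (h1 i hi').mp ((h i hi hi').mpr ho)
  · rw [h1 i hi', h]
    exact ⟨fun c => c.1, fun c => ⟨c, hi, hi'⟩⟩
  · cases q with
    | zero => exact fun x => x.elim0
    | succ q =>
      refine Fin.strictAnti_iff_succ_lt.mpr fun x => ?_
      refine (h2 x.castSucc x.succ (by simp)).mp (h _ (by simp) ?_)
      have := x.succ.2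
      omega
  · obtain ⟨d, rfl⟩ := Nat.exists_eq_add_of_lt hi
    have := (h2 ⟨d, by omega⟩ ⟨d + 1, by omega⟩ rfl).mpr (h (by simp [Fin.lt_def]))
    exact this

-- A strictly decreasing tail is determined by its set of letters, so the words are fibred over that
-- set.
open Classical in
theorem card_block {p q l : ℕ} {S : Set (Fin l → ℤ)} (hS : IsStripClosed S)
    {a : Fin l → ℤ} (ha : a ∈ S) :
    (Finset.univ.filter fun w : Fin (p + q) → Fin l =>
      IsPath S a w ∧ IsBlockDescent p (p + q) (wordDescentSet w)).card =
    ∑ B ∈ Finset.univ.filter fun B : Finset (Fin l) => B.card = q,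
      altCount S p (fun i => a i - if i ∈ B then 1 else 0) := by
  have happ (w : Fin (p + q) → Fin l) :
      Fin.append (fun x => w (Fin.castAdd q x)) (fun x => w (Fin.natAdd p x)) = w :=
    Fin.append_castAdd_natAdd
  rw [Finset.card_eq_sum_card_fiberwise (t := Finset.univ.filter fun B => B.card = q)
    (f := fun w : Fin (p + q) → Fin l => Finset.univ.image fun x : Fin q => w (Fin.natAdd p x))]
  · refine Finset.sum_congr rfl fun B hB => ?_
    have hq : B.card = q := (Finset.mem_filter.mp hB).2
    rw [altCount, Nat.card_eq_fintype_card, Fintype.card_subtype]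
    refine Finset.card_bij' (fun w _ => fun x => w (Fin.castAdd q x))
      (fun u _ => Fin.append u (decreasingWord B hq)) ?_ ?_ ?_ ?_
    · intro w hw
      simp only [Finset.mem_filter, Finset.mem_univ, true_and] at hw ⊢
      obtain ⟨⟨h1, h2⟩, h3⟩ := hw
      rw [← happ w, isBlockDescent_append_iff] at h2
      rw [← happ w, eq_decreasingWord h2.2 hq h3, isPath_append_iff hS ha] at h1
      exact ⟨h1, h2.1⟩
    · intro u hu
      simp only [Finset.mem_filter, Finset.mem_univ, true_and] at hu ⊢
      rw [isPath_append_iff hS ha, isBlockDescent_append_iff]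
      refine ⟨⟨hu.1, hu.2, decreasingWord_strictAnti B hq⟩, ?_⟩
      simp only [Fin.append_right]
      exact image_decreasingWord B hq
    · intro w hw
      simp only [Finset.mem_filter, Finset.mem_univ, true_and] at hw
      obtain ⟨⟨h1, h2⟩, h3⟩ := hw
      rw [← happ w, isBlockDescent_append_iff] at h2
      rw [← eq_decreasingWord h2.2 hq h3, happ w]
    · intro u _
      ext x
      rw [Fin.append_left]
  · intro w hw
    simp only [Finset.coe_filter, Finset.mem_univ, true_and, Set.mem_ofPred_eq] at hw ⊢
    have h2 := hw.2
    rw [← happ w, isBlockDescent_append_iff] at h2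
    rw [Finset.card_image_of_injective _ h2.2.injective, Finset.card_univ, Fintype.card_fin]

theorem altCount_eq_zero {l : ℕ} {S : Set (Fin l → ℤ)} {n : ℕ} {a : Fin l → ℤ}
    (h : ∀ w : Fin n → Fin l, ¬ IsPath S a w) : altCount S n a = 0 := by
  have : IsEmpty {w : Fin n → Fin l // IsPath S a w ∧
      wordDescentSet w = {i | Odd i} ∩ Set.Ico 1 n} := ⟨fun w => h w.1 w.2.1⟩
  exact Nat.card_of_isEmpty

theorem altCount_eq_zero_of_notMem {l : ℕ} {S : Set (Fin l → ℤ)} {n : ℕ} {a : Fin l → ℤ}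
    (h : a ∉ S) : altCount S n a = 0 :=
  altCount_eq_zero fun _ hw => h (hw.1 ▸ hw.2 n)

theorem altCount_eq_zero_of_neg {l : ℕ} {S : Set (Fin l → ℤ)} {n : ℕ} {a : Fin l → ℤ} {i : Fin l}
    (h : a i < 0) : altCount S n a = 0 :=
  altCount_eq_zero fun w hw => by
    have := congrFun hw.1 i
    simp only [prefixContent] at this
    omega

theorem altCount_zero {l : ℕ} {S : Set (Fin l → ℤ)} (h : (fun _ => 0) ∈ S) :
    altCount S 0 (fun _ => 0) = 1 := by
  have hp (w : Fin 0 → Fin l) (k : ℕ) : prefixContent w k = fun _ => 0 := by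
    ext i; simp [prefixContent]
  have hw (w : Fin 0 → Fin l) : IsPath S (fun _ => 0) w ∧
      wordDescentSet w = {i | Odd i} ∩ Set.Ico 1 0 := by
    refine ⟨⟨hp w 0, fun k => by rw [hp]; exact h⟩, ?_⟩
    ext i
    constructor
    · rintro ⟨a, -⟩
      exact a.elim0
    · rintro ⟨-, h1, h2⟩
      omega
  rw [altCount, Nat.card_eq_one_iff_unique]
  exact ⟨⟨fun w w' => Subtype.ext (Subsingleton.elim _ _)⟩, ⟨⟨Fin.elim0, hw _⟩⟩⟩

/-- A tail starting after position `2t` has `q = n - 2t` letters, whence the parity condition in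
`blocks`; the telescoping sign `(-1)^(s - t)` is `(-1)^((q - 1) / 2)`. -/
theorem altCount_recurrence {l : ℕ} {S : Set (Fin l → ℤ)} (hS : IsStripClosed S) {n : ℕ}
    (hn : n ≠ 0) {a : Fin l → ℤ} (ha : a ∈ S) (hs : ∑ i, a i = n) :
    (altCount S n a : ℤ) = ∑ B ∈ blocks l n, (-1) ^ ((B.card - 1) / 2) *
      (altCount S (n - B.card) (fun i => a i - if i ∈ B then 1 else 0) : ℤ) := by
  classical
  set s := (n - 1) / 2 with hsdef
  have h1 : (altCount S n a : ℤ) = ∑ t ∈ Finset.range (s + 1), (-1) ^ (s - t) *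
      ((Finset.univ.filter fun w : Fin n → Fin l =>
        IsPath S a w ∧ IsBlockDescent (2 * t) n (wordDescentSet w)).card : ℤ) := by
    rw [altCount, Nat.card_eq_fintype_card, Fintype.card_subtype]
    simp only [← Finset.filter_filter, Finset.card_filter, Nat.cast_sum, Finset.mul_sum]
    rw [Finset.sum_comm]
    refine Finset.sum_congr rfl fun w _ => ?_
    have hsub := wordDescentSet_subset w
    have hw := indicator_block (wordDescentSet w) (fun h => by have := (hsub h).1; omega)
      (n := n) (s := s) (by omega)
    push_cast
    rw [← hw]
    exact if_congr (eq_odd_inter_iff hsub) rfl rfl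
  have h2 : ∀ t ∈ Finset.range (s + 1), (-1) ^ (s - t) *
      ((Finset.univ.filter fun w : Fin n → Fin l =>
        IsPath S a w ∧ IsBlockDescent (2 * t) n (wordDescentSet w)).card : ℤ) =
      ∑ B ∈ Finset.univ.filter fun B : Finset (Fin l) => B.card = n - 2 * t,
        (-1) ^ ((B.card - 1) / 2) *
        (altCount S (n - B.card) (fun i => a i - if i ∈ B then 1 else 0) : ℤ) := by
    intro t ht
    rw [Finset.mem_range] at ht
    obtain ⟨q, rfl⟩ := Nat.exists_eq_add_of_le (show 2 * t ≤ n by omega)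
    rw [card_block hS ha, Nat.cast_sum, Finset.mul_sum]
    rw [Nat.add_sub_cancel_left]
    refine Finset.sum_congr rfl fun B hB => ?_
    rw [(Finset.mem_filter.mp hB).2, Nat.add_sub_cancel, show (q - 1) / 2 = s - t by omega]
  rw [h1, Finset.sum_congr rfl h2]
  -- Sets with more than `n` letters contribute nothing: the truncated length is 0 but the content
  -- has negative sum.
  have h3 : ∑ B ∈ blocks l n, (-1) ^ ((B.card - 1) / 2) *
      (altCount S (n - B.card) (fun i => a i - if i ∈ B then 1 else 0) : ℤ) =
      ∑ B ∈ (blocks l n).filter (fun B => B.card ≤ n), (-1) ^ ((B.card - 1) / 2) *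
      (altCount S (n - B.card) (fun i => a i - if i ∈ B then 1 else 0) : ℤ) := by
    refine (Finset.sum_filter_of_ne fun B _ hne => ?_).symm
    by_contra hc
    apply hne
    rw [altCount_eq_zero, Nat.cast_zero, mul_zero]
    intro w hw
    have := sum_prefixContent w
    rw [hw.1, Finset.sum_sub_distrib, hs] at this
    simp at this
    omega
  rw [h3, ← Finset.sum_fiberwise_of_maps_to (t := Finset.range (s + 1))
    (g := fun B : Finset (Fin l) => (n - B.card) / 2)]
  · refine Finset.sum_congr rfl fun t ht => Finset.sum_congr ?_ fun _ _ => rfl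
    rw [Finset.mem_range] at ht
    ext B
    simp only [blocks, Finset.mem_filter, Finset.mem_univ, true_and, ← Finset.card_pos,
      Nat.even_iff]
    omega
  · intro B hB
    simp only [blocks, Finset.mem_filter, Finset.mem_univ, true_and, ← Finset.card_pos,
      Nat.even_iff] at hB
    rw [Finset.mem_range]
    omega

end Words

/-! ### Euler numbers as counts of words. -/

section Euler

theorem bijective_of_prefixContent {n : ℕ} {w : Fin n → Fin n}
    (h : prefixContent w n = fun _ => 1) : Function.Bijective w := by
  refine Finite.injective_iff_bijective.mp fun x y hxy => ?_
  have h1 := congrFun h (w y)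
  simp only [prefixContent, Fin.is_lt, true_and] at h1
  have h2 : (Finset.univ.filter fun z => w z = w y).card ≤ 1 := by exact_mod_cast h1.le
  exact Finset.card_le_one.mp h2 x (by simp [hxy]) y (by simp)

theorem prefixContent_perm {n : ℕ} (w : Equiv.Perm (Fin n)) :
    prefixContent w n = fun _ => 1 := by
  ext i
  simp only [prefixContent, Fin.is_lt, true_and]
  have : (Finset.univ.filter fun z => w z = i) = {w.symm i} := by
    ext z
    simp [Equiv.eq_symm_apply]
  rw [this]
  simp

theorem eulerNumber_eq_altCount (n : ℕ) :
    eulerNumber n = altCount Set.univ n (fun _ : Fin n => 1) := by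
  refine Nat.card_congr (Equiv.ofBijective (fun w => ⟨w.1, ⟨prefixContent_perm w.1, fun _ =>
    Set.mem_univ _⟩, w.2⟩) ⟨fun w w' h => ?_, fun w => ?_⟩)
  · exact Subtype.ext (DFunLike.coe_injective (congrArg Subtype.val h))
  · exact ⟨⟨Equiv.ofBijective w.1 (bijective_of_prefixContent w.2.1.1), w.2.2⟩, rfl⟩

theorem isStripClosed_univ {l : ℕ} : IsStripClosed (Set.univ : Set (Fin l → ℤ)) :=
  fun _ _ _ _ _ _ _ => Set.mem_univ _

theorem sum_blocks_eq_choose {l n : ℕ} (C : Finset (Fin l)) (hC : C.card = n) (g : ℕ → ℤ) :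
    ∑ B ∈ (blocks l n).filter (fun B => B ⊆ C), g B.card =
      ∑ k ∈ Finset.range (n + 1), n.choose k * (if 0 < k ∧ Even (n + k) then g k else 0) := by
  have h := Finset.sum_powerset_apply_card (fun k => if 0 < k ∧ Even (n + k) then g k else 0)
    (x := C)
  rw [hC] at h
  simp only [nsmul_eq_mul] at h
  rw [← h, ← Finset.sum_filter]
  refine Finset.sum_congr ?_ fun _ _ => rfl
  ext B
  simp only [blocks, Finset.mem_filter, Finset.mem_univ, true_and, Finset.mem_powerset,
    Finset.card_pos]
  tauto

/-- Removing `B` from a permutation leaves a word on part of the alphabet. That only the number of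
letters matters follows by induction from the recurrence, without relabelling words. -/
theorem altCount_indicator {n : ℕ} : ∀ {l : ℕ} (C : Finset (Fin l)), C.card = n →
    altCount Set.univ n (fun i => if i ∈ C then 1 else 0) = eulerNumber n := by
  induction n using Nat.strong_induction_on with
  | _ n ih =>
  rcases eq_or_ne n 0 with rfl | hn
  · intro l C hC
    rw [Finset.card_eq_zero] at hC
    have e : (fun _ : Fin 0 => (1 : ℤ)) = fun _ => 0 := Subsingleton.elim _ _
    rw [eulerNumber_eq_altCount, e, altCount_zero (Set.mem_univ _)]
    simp only [hC, Finset.notMem_empty, if_false]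
    exact altCount_zero (Set.mem_univ _)
  have key : ∀ {l : ℕ} (C : Finset (Fin l)), C.card = n →
      (altCount Set.univ n (fun i => if i ∈ C then 1 else 0) : ℤ) =
      ∑ k ∈ Finset.range (n + 1), n.choose k *
        (if 0 < k ∧ Even (n + k) then (-1) ^ ((k - 1) / 2) * (eulerNumber (n - k) : ℤ) else 0) := by
    intro l C hC
    rw [← sum_blocks_eq_choose C hC, altCount_recurrence isStripClosed_univ hn (Set.mem_univ _)
      (by simp [hC])]
    symm
    rw [Finset.sum_congr rfl (g := fun B => (-1) ^ ((B.card - 1) / 2) * (altCount Set.univ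
      (n - B.card) (fun i => (if i ∈ C then 1 else 0) - if i ∈ B then 1 else 0) : ℤ))]
    · refine Finset.sum_filter_of_ne fun B _ hne => ?_
      by_contra hc
      obtain ⟨i, hi, hi'⟩ := Finset.not_subset.mp hc
      rw [altCount_eq_zero_of_neg (i := i) (by simp [hi, hi'])] at hne
      simp at hne
    · intro B hB
      simp only [blocks, Finset.mem_filter, Finset.mem_univ, true_and] at hB
      have h1 : (fun i => (if i ∈ C then (1 : ℤ) else 0) - if i ∈ B then 1 else 0) =
          fun i => if i ∈ C \ B then 1 else 0 := by
        ext i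
        have := @hB.2 i
        by_cases h1 : i ∈ C <;> by_cases h2 : i ∈ B <;> simp_all
      have hpos := hB.1.1.card_pos
      have hle := Finset.card_le_card hB.2
      rw [h1, ih (n - B.card) (by omega) (C \ B) (by rw [Finset.card_sdiff_of_subset hB.2, hC])]
  intro l C hC
  zify
  rw [key C hC, eulerNumber_eq_altCount, ← key (Finset.univ : Finset (Fin n)) (by simp)]
  simp

theorem eulerRecurrence_eulerNumber : EulerRecurrence fun n => (eulerNumber n : ℂ) := by
  refine ⟨?_, fun n hn => ?_⟩
  · have e : (fun _ : Fin 0 => (1 : ℤ)) = fun _ => 0 := Subsingleton.elim _ _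
    change (eulerNumber 0 : ℂ) = 1
    rw [eulerNumber_eq_altCount, e, altCount_zero (Set.mem_univ _), Nat.cast_one]
  · have h1 := altCount_recurrence isStripClosed_univ hn (Set.mem_univ _)
      (a := fun _ : Fin n => 1) (by simp)
    rw [← eulerNumber_eq_altCount] at h1
    have h2 : (eulerNumber n : ℤ) = ∑ B ∈ blocks n n, (-1) ^ ((B.card - 1) / 2) *
        (eulerNumber (n - B.card) : ℤ) := by
      rw [h1]
      refine Finset.sum_congr rfl fun B _ => ?_
      have hB : (fun i : Fin n => (1 : ℤ) - if i ∈ B then 1 else 0) =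
          fun i => if i ∈ Bᶜ then 1 else 0 := by
        ext i
        by_cases h2 : i ∈ B <;> simp [h2]
      rw [hB, altCount_indicator Bᶜ (by simp [Finset.card_compl])]
    have h3 := congrArg (Int.cast : ℤ → ℂ) h2
    push_cast at h3
    exact h3

end Euler

/-! ### Words with partition prefixes. -/

section MonotonePaths

/-- A monotone content lists row lengths from bottom to top, and `B` adds at most one cell per row.
Adding these cells from the top row down never makes a lower row longer than a higher one. -/
theorem isStripClosed_monotone {l : ℕ} : IsStripClosed {a : Fin l → ℤ | Monotone a} := by
  intro a B U hU hup ha hB i j hij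
  have h1 := ha hij
  have h2 := hB hij
  simp only at h2 ⊢
  by_cases hi : i ∈ U
  · rw [if_pos (hU hi)] at h2
    rw [if_pos hi]
    by_cases hj : j ∈ B
    · rw [if_pos (hup i hi j hj hij)]
      rwa [if_pos hj] at h2
    · rw [if_neg hj] at h2
      rwa [if_neg fun c => hj (hU c)]
  · rw [if_neg hi]
    split_ifs <;> omega

theorem altCount_monotone_eq_altValue {e : ℕ → ℂ} (he : EulerRecurrence e) {l n : ℕ}
    {a : Fin l → ℤ} (ha : Monotone a) (h0 : ∀ i, 0 ≤ a i) (hs : ∑ i, a i = n) :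
    (altCount {a : Fin l → ℤ | Monotone a} n a : ℂ) = altValue e n a := by
  induction n using Nat.strong_induction_on generalizing a with
  | _ n ih =>
  rcases eq_or_ne n 0 with rfl | hn
  · have : a = fun _ => 0 := by
      ext i
      exact (Finset.sum_eq_zero_iff_of_nonneg fun i _ => h0 i).mp (by simpa using hs) i
        (Finset.mem_univ i)
    rw [this, altValue_zero he, altCount_zero (S := {a : Fin l → ℤ | Monotone a}) monotone_const,
      Nat.cast_one]
  have h1 := congrArg (Int.cast : ℤ → ℂ) (altCount_recurrence isStripClosed_monotone hn ha hs)
  push_cast at h1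
  rw [h1, altValue_recurrence he hn ha h0 hs]
  refine Finset.sum_congr rfl fun B hB => ?_
  congr 1
  by_cases hb : Monotone (fun i => a i - if i ∈ B then 1 else 0) ∧
      ∀ i, 0 ≤ a i - if i ∈ B then 1 else 0
  · have hsum : ∑ i, (a i - if i ∈ B then 1 else 0) = (n : ℤ) - B.card := by
      rw [Finset.sum_sub_distrib, hs]
      simp
    have hle : (B.card : ℤ) ≤ n := by
      have := Finset.sum_nonneg fun i (_ : i ∈ Finset.univ) => hb.2 i
      omega
    simp only [blocks, Finset.mem_filter, Finset.mem_univ, true_and, ← Finset.card_pos] at hB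
    exact ih _ (by omega) hb.1 hb.2 (by rw [hsum]; omega)
  · rw [altValue, altDet_shift_eq_zero _ _ _ hb, map_zero, Nat.cast_eq_zero]
    · rcases not_and_or.mp hb with h | h
      · exact altCount_eq_zero_of_notMem h
      · push Not at h
        obtain ⟨i, hi⟩ := h
        exact altCount_eq_zero_of_neg hi
    · intro i j hij
      have := ha hij
      split_ifs <;> omega
    · intro i
      have := h0 i
      split_ifs <;> omega

end MonotonePaths

/-! ### Tableaux as words, and transposition. -/

/-- Converts the monotonicity of prefix contents, a comparison of counts, into a comparison of the
`j`-th occurrences of two letters, as needed for the columns of a tableau. -/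
theorem orderEmbOfFin_le_iff {α : Type*} [LinearOrder α] (s : Finset α) {r : ℕ} (h : s.card = r)
    (j : Fin r) (x : α) :
    s.orderEmbOfFin h j ≤ x ↔ (j : ℕ) < (s.filter fun y => y ≤ x).card := by
  have hmap : (s.filter fun y => y ≤ x) =
      (Finset.univ.filter fun i => s.orderEmbOfFin h i ≤ x).map (s.orderEmbOfFin h).toEmbedding := by
    ext y
    simp only [Finset.mem_filter, Finset.mem_map, Finset.mem_univ, true_and]
    constructor
    · rintro ⟨hy, hi⟩
      rw [← Finset.mem_coe, ← Finset.range_orderEmbOfFin s h] at hy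
      obtain ⟨i, rfl⟩ := hy
      exact ⟨i, hi, rfl⟩
    · rintro ⟨i, hi, rfl⟩
      exact ⟨Finset.orderEmbOfFin_mem s h i, hi⟩
  rw [hmap, Finset.card_map]
  constructor
  · intro hj
    have : Finset.Iic j ⊆ Finset.univ.filter fun i => s.orderEmbOfFin h i ≤ x := by
      intro i hi
      rw [Finset.mem_Iic] at hi
      simp only [Finset.mem_filter, Finset.mem_univ, true_and]
      exact ((s.orderEmbOfFin h).monotone hi).trans hj
    have := Finset.card_le_card this
    rw [Fin.card_Iic] at this
    omega
  · intro hj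
    by_contra hc
    have : (Finset.univ.filter fun i => s.orderEmbOfFin h i ≤ x) ⊆ Finset.Iio j := by
      intro i hi
      simp only [Finset.mem_filter, Finset.mem_univ, true_and] at hi
      rw [Finset.mem_Iio]
      by_contra hij
      exact hc (((s.orderEmbOfFin h).monotone (not_lt.mp hij)).trans hi)
    have := Finset.card_le_card this
    rw [Fin.card_Iio] at this
    omega

namespace StandardYoungTableau

variable {μ : YoungDiagram}

section Word

theorem exists_cell (T : StandardYoungTableau μ) (x : Fin μ.card) :
    ∃ c ∈ μ, T.entry c = x + 1 := by
  obtain ⟨c, hc, h⟩ := T.bijOn.surjOn (show (x : ℕ) + 1 ∈ Set.Icc 1 μ.card by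
    have := x.2
    simp only [Set.mem_Icc]
    omega)
  exact ⟨c, hc, h⟩

theorem entry_pos (T : StandardYoungTableau μ) {c : ℕ × ℕ} (hc : c ∈ μ) : 1 ≤ T.entry c :=
  (T.bijOn.mapsTo hc).1

theorem entry_le (T : StandardYoungTableau μ) {c : ℕ × ℕ} (hc : c ∈ μ) : T.entry c ≤ μ.card :=
  (T.bijOn.mapsTo hc).2

theorem entry_inj (T : StandardYoungTableau μ) {c d : ℕ × ℕ} (hc : c ∈ μ) (hd : d ∈ μ)
    (h : T.entry c = T.entry d) : c = d :=
  T.bijOn.injOn hc hd h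

theorem entry_mono (T : StandardYoungTableau μ) {i i' j j' : ℕ} (hi : i ≤ i') (hj : j ≤ j')
    (h : (i', j') ∈ μ) : T.entry (i, j) ≤ T.entry (i', j') := by
  have h1 : T.entry (i, j) ≤ T.entry (i, j') := by
    rcases hj.eq_or_lt with rfl | hj
    · exact le_rfl
    · exact (T.row_strict i j j' hj (μ.up_left_mem hi le_rfl h)).le
  have h2 : T.entry (i, j') ≤ T.entry (i', j') := by
    rcases hi.eq_or_lt with rfl | hi
    · exact le_rfl
    · exact (T.col_strict i i' j' hi h).le
  exact h1.trans h2

/-- The word recording the rows of the entries `1, 2, …`, where the letters number the rows from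
bottom to top. -/
def word {l : ℕ} (hl : ∀ c ∈ μ, c.1 < l) (T : StandardYoungTableau μ) : Fin μ.card → Fin l :=
  fun x => Fin.rev ⟨(T.exists_cell x).choose.1, hl _ (T.exists_cell x).choose_spec.1⟩

variable {l : ℕ} (hl : ∀ c ∈ μ, c.1 < l)

theorem word_eq_iff (T : StandardYoungTableau μ) {c : ℕ × ℕ} (hc : c ∈ μ) {x : Fin μ.card}
    (h : T.entry c = x + 1) (i : Fin l) : T.word hl x = i ↔ c.1 = i.rev := by
  have e : (T.exists_cell x).choose = c :=
    T.entry_inj (T.exists_cell x).choose_spec.1 hc ((T.exists_cell x).choose_spec.2.trans h.symm)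
  rw [word, Fin.rev_eq_iff, Fin.ext_iff]
  simp only [e]

theorem prefixContent_word (T : StandardYoungTableau μ) (k : ℕ) (i : Fin l) :
    prefixContent (T.word hl) k i =
      ((Finset.range (μ.rowLen i.rev)).filter fun j => T.entry (i.rev, j) ≤ k).card := by
  rw [prefixContent, Nat.cast_inj]
  symm
  refine Finset.card_bij (fun j hj => ⟨T.entry ((i.rev : ℕ), j) - 1, ?_⟩) ?_ ?_ ?_
  · rw [Finset.mem_filter, Finset.mem_range, ← YoungDiagram.mem_iff_lt_rowLen] at hj
    have := T.entry_pos hj.1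
    have := T.entry_le hj.1
    omega
  · intro j hj
    rw [Finset.mem_filter, Finset.mem_range, ← YoungDiagram.mem_iff_lt_rowLen] at hj
    have := T.entry_pos hj.1
    simp only [Finset.mem_filter, Finset.mem_univ, true_and]
    refine ⟨by omega, (T.word_eq_iff hl hj.1 ?_ i).mpr rfl⟩
    simp only
    omega
  · intro j hj j' hj' h
    rw [Finset.mem_filter, Finset.mem_range, ← YoungDiagram.mem_iff_lt_rowLen] at hj hj'
    have h1 := T.entry_pos hj.1
    have h2 := T.entry_pos hj'.1
    simp only [Fin.mk.injEq] at h
    have := T.entry_inj hj.1 hj'.1 (by omega)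
    simpa using this
  · intro x hx
    simp only [Finset.mem_filter, Finset.mem_univ, true_and] at hx
    obtain ⟨⟨r, j⟩, hc, h⟩ := T.exists_cell x
    have hr := (T.word_eq_iff hl hc h i).mp hx.2
    simp only at hr
    subst hr
    refine ⟨j, ?_, Fin.ext ?_⟩
    · rw [Finset.mem_filter, Finset.mem_range, ← YoungDiagram.mem_iff_lt_rowLen]
      exact ⟨hc, by omega⟩
    · simp only
      omega

theorem isPath_word (T : StandardYoungTableau μ) :
    IsPath {a : Fin l → ℤ | Monotone a} (fun i => (μ.rowLen i.rev : ℤ)) (T.word hl) := by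
  refine ⟨funext fun i => ?_, fun k i i' hii' => ?_⟩
  · rw [prefixContent_word, Finset.filter_true_of_mem, Finset.card_range]
    intro j hj
    rw [Finset.mem_range, ← YoungDiagram.mem_iff_lt_rowLen] at hj
    exact T.entry_le hj
  · rw [prefixContent_word, prefixContent_word, Nat.cast_le]
    refine Finset.card_le_card fun j hj => ?_
    rw [Finset.mem_filter, Finset.mem_range, ← YoungDiagram.mem_iff_lt_rowLen] at hj ⊢
    have hr : (i'.rev : ℕ) ≤ i.rev := Fin.rev_le_rev.mpr hii'
    exact ⟨μ.up_left_mem hr le_rfl hj.1, (T.entry_mono hr le_rfl hj.1).trans hj.2⟩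

theorem wordDescentSet_word (T : StandardYoungTableau μ) :
    wordDescentSet (T.word hl) = T.descentSet := by
  ext i
  constructor
  · rintro ⟨a, b, ha, hb, hab⟩
    obtain ⟨c, hc, h⟩ := T.exists_cell a
    obtain ⟨d, hd, h'⟩ := T.exists_cell b
    refine ⟨c, hc, d, hd, by omega, by omega, ?_⟩
    rw [(T.word_eq_iff hl hc h _).mp rfl, (T.word_eq_iff hl hd h' _).mp rfl]
    exact Fin.rev_lt_rev.mpr hab
  · rintro ⟨c, hc, d, hd, h, h', hcd⟩
    have h1 := T.entry_pos hc
    have h2 := T.entry_le hd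
    refine ⟨⟨i - 1, by omega⟩, ⟨i, by omega⟩, by simp only; omega, rfl, ?_⟩
    rw [← Fin.rev_lt_rev, Fin.lt_def, ← (T.word_eq_iff hl hc (by simp only; omega) _).mp rfl,
      ← (T.word_eq_iff hl hd (by simp only; omega) _).mp rfl]
    exact hcd

/-- A row is strictly increasing, hence determined by its set of entries, which the word shows. -/
theorem word_injective : Function.Injective (word hl : StandardYoungTableau μ → _) := by
  intro T T' hTT'
  apply entry_injective
  ext ⟨r, j⟩
  by_cases hc : (r, j) ∈ μ
  · have hmono (U : StandardYoungTableau μ) :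
        StrictMono fun j : Fin (μ.rowLen r) => U.entry (r, j) := fun j j' h =>
      U.row_strict r j j' h (YoungDiagram.mem_iff_lt_rowLen.mpr j'.2)
    have hrange (U : StandardYoungTableau μ) : Set.range (fun j : Fin (μ.rowLen r) => U.entry (r, j))
        = {y | ∃ x : Fin μ.card, y = (x : ℕ) + 1 ∧ U.word hl x = Fin.rev ⟨r, hl _ hc⟩} := by
      ext y
      constructor
      · rintro ⟨j, rfl⟩
        have hj : (r, (j : ℕ)) ∈ μ := YoungDiagram.mem_iff_lt_rowLen.mpr j.2
        have h1 := U.entry_pos hj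
        have h2 := U.entry_le hj
        refine ⟨⟨U.entry (r, j) - 1, by omega⟩, by simp only; omega, ?_⟩
        rw [U.word_eq_iff hl hj (by simp only; omega), Fin.rev_rev]
      · rintro ⟨x, rfl, hx⟩
        obtain ⟨⟨r', j⟩, hd, h⟩ := U.exists_cell x
        rw [U.word_eq_iff hl hd h, Fin.rev_rev] at hx
        simp only at hx
        subst hx
        exact ⟨⟨j, YoungDiagram.mem_iff_lt_rowLen.mp hd⟩, h⟩
    have h := (hmono T).range_inj (hmono T') |>.mp (by rw [hrange, hrange, hTT'])
    exact congrFun h ⟨j, YoungDiagram.mem_iff_lt_rowLen.mp hc⟩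
  · rw [T.zeros _ hc, T'.zeros _ hc]

/-- The positions of a letter in a word. -/
def positions {n : ℕ} (w : Fin n → Fin l) (i : Fin l) : Finset (Fin n) :=
  Finset.univ.filter fun x => w x = i

theorem card_positions {n : ℕ} {S : Set (Fin l → ℤ)} {w : Fin n → Fin l}
    (hw : IsPath S (fun i => (μ.rowLen i.rev : ℤ)) w) (i : Fin l) :
    (positions w i).card = μ.rowLen i.rev := by
  have := congrFun hw.1 i
  simp only [prefixContent, Fin.is_lt, true_and, Nat.cast_inj] at this
  exact this

/-- The `j`-th cell of a row receives the position of the `j`-th occurrence of its letter. Columns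
increase because at every moment a higher row has at least as many entries as a lower one. -/
theorem word_surjective {w : Fin μ.card → Fin l}
    (hw : IsPath {a : Fin l → ℤ | Monotone a} (fun i => (μ.rowLen i.rev : ℤ)) w) :
    ∃ T : StandardYoungTableau μ, T.word hl = w := by
  have hcard (r : Fin l) : (positions w r.rev).card = μ.rowLen r := by
    rw [card_positions hw, Fin.rev_rev]
  let pos (r : Fin l) : Fin (μ.rowLen r) ↪o Fin μ.card :=
    (positions w r.rev).orderEmbOfFin (hcard r)
  have hpos (r : Fin l) (j : Fin (μ.rowLen r)) : w (pos r j) = r.rev := by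
    have := Finset.orderEmbOfFin_mem (positions w r.rev) (hcard r) j
    exact (Finset.mem_filter.mp this).2
  classical
  let f : ℕ × ℕ → ℕ := fun c => if h : c ∈ μ then
    (pos ⟨c.1, hl c h⟩ ⟨c.2, YoungDiagram.mem_iff_lt_rowLen.mp h⟩ : ℕ) + 1 else 0
  have hf {r j : ℕ} (h : (r, j) ∈ μ) :
      f (r, j) = (pos ⟨r, hl _ h⟩ ⟨j, YoungDiagram.mem_iff_lt_rowLen.mp h⟩ : ℕ) + 1 := dif_pos h
  have hbij : Set.BijOn f (μ.cells : Set (ℕ × ℕ)) (Set.Icc 1 μ.card) := by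
    refine ⟨?_, ?_, ?_⟩
    · rintro ⟨r, j⟩ h
      rw [hf h]
      have := (pos ⟨r, hl _ h⟩ ⟨j, YoungDiagram.mem_iff_lt_rowLen.mp h⟩).2
      simp only [Set.mem_Icc]
      omega
    · rintro ⟨r, j⟩ h ⟨r', j'⟩ h' e
      rw [hf h, hf h', Nat.add_right_cancel_iff] at e
      have e := Fin.ext e
      have hr := congrArg w e
      rw [hpos, hpos, Fin.rev_inj, Fin.mk.injEq] at hr
      subst hr
      have := (pos ⟨r, hl _ h⟩).injective e
      rw [Fin.mk.injEq] at this
      rw [this]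
    · intro y hy
      have hy1 := hy.1
      have hy2 := hy.2
      have hr := Finset.range_orderEmbOfFin (positions w (w ⟨y - 1, by omega⟩).rev.rev)
        (hcard (w ⟨y - 1, by omega⟩).rev)
      have hm : (⟨y - 1, by omega⟩ : Fin μ.card) ∈ (positions w (w ⟨y - 1, by omega⟩).rev.rev) := by
        simp [positions]
      rw [← Finset.mem_coe, ← hr] at hm
      obtain ⟨j, hj⟩ := hm
      have hc : (((w ⟨y - 1, by omega⟩).rev : ℕ), (j : ℕ)) ∈ μ :=
        YoungDiagram.mem_iff_lt_rowLen.mpr j.2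
      refine ⟨_, hc, ?_⟩
      rw [hf hc]
      have := congrArg Fin.val hj
      simp only at this
      change ((positions w (w ⟨y - 1, by omega⟩).rev.rev).orderEmbOfFin
        (hcard (w ⟨y - 1, by omega⟩).rev) j : ℕ) + 1 = y
      rw [this]
      omega
  have hrow : ∀ i j₁ j₂ : ℕ, j₁ < j₂ → (i, j₂) ∈ μ → f (i, j₁) < f (i, j₂) := by
    intro i j₁ j₂ hj h
    rw [hf h, hf (μ.up_left_mem le_rfl hj.le h)]
    exact Nat.succ_lt_succ ((pos ⟨i, hl _ h⟩).strictMono (Fin.mk_lt_mk.mpr hj))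
  have hcol : ∀ i₁ i₂ j : ℕ, i₁ < i₂ → (i₂, j) ∈ μ → f (i₁, j) < f (i₂, j) := by
    intro i₁ i₂ j hi h
    have h' := μ.up_left_mem hi.le le_rfl h
    rw [hf h, hf h']
    set x := pos ⟨i₂, hl _ h⟩ ⟨j, YoungDiagram.mem_iff_lt_rowLen.mp h⟩ with hx
    have hle : pos ⟨i₁, hl _ h'⟩ ⟨j, YoungDiagram.mem_iff_lt_rowLen.mp h'⟩ ≤ x := by
      have h1 := (orderEmbOfFin_le_iff _ (hcard ⟨i₂, hl _ h⟩)
        ⟨j, YoungDiagram.mem_iff_lt_rowLen.mp h⟩ x).mp le_rfl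
      refine (orderEmbOfFin_le_iff _ (hcard ⟨i₁, hl _ h'⟩) _ x).mpr (h1.trans_le ?_)
      have h2 := hw.2 (x + 1) (show Fin.rev ⟨i₂, hl _ h⟩ ≤ Fin.rev ⟨i₁, hl _ h'⟩ from
        Fin.rev_le_rev.mpr (Fin.mk_le_mk.mpr hi.le))
      simp only [prefixContent, Nat.cast_le, Nat.lt_succ_iff] at h2
      refine le_trans (le_of_eq ?_) (h2.trans (le_of_eq ?_)) <;>
      · congr 1
        ext y
        simp only [positions, Finset.mem_filter, Finset.mem_univ, true_and, Fin.le_def]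
        exact and_comm
    have hne : pos ⟨i₁, hl _ h'⟩ ⟨j, YoungDiagram.mem_iff_lt_rowLen.mp h'⟩ ≠ x := by
      intro e
      have := congrArg w e
      rw [hx, hpos, hpos, Fin.rev_inj, Fin.mk.injEq] at this
      omega
    exact Nat.succ_lt_succ (lt_of_le_of_ne (α := Fin μ.card) hle hne)
  let T : StandardYoungTableau μ := ⟨f, hbij, hrow, hcol, fun c hc => dif_neg hc⟩
  refine ⟨T, funext fun x => ?_⟩
  obtain ⟨⟨r, j⟩, hc, h⟩ := T.exists_cell x
  rw [T.word_eq_iff hl hc h]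
  have hx : (pos ⟨r, hl _ hc⟩ ⟨j, YoungDiagram.mem_iff_lt_rowLen.mp hc⟩) = x := by
    have h1 : f (r, j) = x + 1 := h
    rw [hf hc] at h1
    exact Fin.ext (by omega)
  rw [← hx, hpos, Fin.rev_rev]

end Word

section Transpose

/-- The transpose of a standard Young tableau of self-conjugate shape. -/
def transpose (hμ : ∀ c, c.swap ∈ μ ↔ c ∈ μ) (T : StandardYoungTableau μ) :
    StandardYoungTableau μ where
  entry := fun c => T.entry c.swap
  bijOn := T.bijOn.comp ⟨fun c hc => (hμ c).mpr hc, Prod.swap_injective.injOn,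
    fun c hc => ⟨c.swap, (hμ c).mpr hc, c.swap_swap⟩⟩
  row_strict := fun i j₁ j₂ hj h => T.col_strict j₁ j₂ i hj ((hμ (i, j₂)).mpr h)
  col_strict := fun i₁ i₂ j hi h => T.row_strict j i₁ i₂ hi ((hμ (i₂, j)).mpr h)
  zeros := fun c hc => T.zeros _ fun h => hc ((hμ c).mp h)

variable (hμ : ∀ c, c.swap ∈ μ ↔ c ∈ μ)

theorem transpose_transpose (T : StandardYoungTableau μ) :
    (T.transpose hμ).transpose hμ = T :=
  entry_injective rfl

theorem descentSet_subset (T : StandardYoungTableau μ) : T.descentSet ⊆ Set.Ico 1 μ.card := by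
  rintro i ⟨c, hc, d, hd, h, h', -⟩
  have h1 := T.entry_pos hc
  have h2 := T.entry_le hd
  simp only [Set.mem_Ico]
  omega

/-- If `i + 1` is not in a lower row than `i`, it is in a column strictly to the right. Both cannot
happen: the cell in the row of `i` and the column of `i + 1` would hold an entry strictly between
them. -/
theorem descentSet_transpose (T : StandardYoungTableau μ) :
    (T.transpose hμ).descentSet = Set.Ico 1 μ.card \ T.descentSet := by
  ext i
  constructor
  · intro hi
    refine ⟨(T.transpose hμ).descentSet_subset hi, ?_⟩
    rintro ⟨c, hc, d, hd, h, h', hcd⟩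
    obtain ⟨c', hc', d', hd', e, e', hcd'⟩ := hi
    have ec : c'.swap = c := T.entry_inj ((hμ c').mpr hc') hc (e.trans h.symm)
    have ed : d'.swap = d := T.entry_inj ((hμ d').mpr hd') hd (e'.trans h'.symm)
    have hcd2 : c.2 < d.2 := by rw [← ec, ← ed]; exact hcd'
    obtain ⟨c1, c2⟩ := c
    obtain ⟨d1, d2⟩ := d
    have hm : (c1, d2) ∈ μ := μ.up_left_mem (le_of_lt hcd) le_rfl hd
    have h1 := T.row_strict c1 c2 d2 hcd2 hm
    have h2 := T.col_strict c1 d1 d2 hcd hd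
    omega
  · rintro ⟨⟨h1, h2⟩, hi⟩
    obtain ⟨c, hc, h⟩ := T.exists_cell ⟨i - 1, by omega⟩
    obtain ⟨d, hd, h'⟩ := T.exists_cell ⟨i, h2⟩
    simp only at h h'
    have hle : d.1 ≤ c.1 := by
      by_contra hlt
      exact hi ⟨c, hc, d, hd, by omega, by omega, not_le.mp hlt⟩
    have hlt : c.2 < d.2 := by
      by_contra hge
      have := T.entry_mono hle (not_lt.mp hge) hc
      simp only [Prod.mk.eta] at this
      omega
    refine ⟨c.swap, (hμ c).mpr hc, d.swap, (hμ d).mpr hd, ?_, ?_, hlt⟩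
    · change T.entry c.swap.swap = i
      rw [Prod.swap_swap]; omega
    · change T.entry d.swap.swap = i + 1
      rw [Prod.swap_swap]; omega

end Transpose

end StandardYoungTableau

theorem alt_eq_altCount {μ : YoungDiagram} {l : ℕ} (hl : ∀ c ∈ μ, c.1 < l) :
    alt μ = altCount {a : Fin l → ℤ | Monotone a} μ.card (fun i => (μ.rowLen i.rev : ℤ)) := by
  refine Nat.card_congr (Equiv.ofBijective (fun T => ⟨T.1.word hl, T.1.isPath_word hl, by
    rw [T.1.wordDescentSet_word hl]; exact T.2⟩) ⟨fun T T' h => ?_, fun w => ?_⟩)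
  · exact Subtype.ext (StandardYoungTableau.word_injective hl (congrArg Subtype.val h))
  · obtain ⟨T, hT⟩ := StandardYoungTableau.word_surjective hl w.2.1
    refine ⟨⟨T, ?_⟩, Subtype.ext hT⟩
    rw [StandardYoungTableau.IsAlternating, ← T.wordDescentSet_word hl, hT]
    exact w.2.2

theorem alt_eq_ralt {μ : YoungDiagram} (hμ : ∀ c, c.swap ∈ μ ↔ c ∈ μ) : alt μ = ralt μ := by
  have h1 (T : StandardYoungTableau μ) (h : T.IsAlternating) :
      (T.transpose hμ).IsReverseAlternating := by
    rw [StandardYoungTableau.IsReverseAlternating, StandardYoungTableau.descentSet_transpose, h]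
    ext i
    simp only [Set.mem_sdiff, Set.mem_inter_iff, Set.mem_ofPred_eq, ← Nat.not_even_iff_odd]
    tauto
  have h2 (T : StandardYoungTableau μ) (h : T.IsReverseAlternating) :
      (T.transpose hμ).IsAlternating := by
    rw [StandardYoungTableau.IsAlternating, StandardYoungTableau.descentSet_transpose, h]
    ext i
    simp only [Set.mem_sdiff, Set.mem_inter_iff, Set.mem_ofPred_eq, ← Nat.not_even_iff_odd]
    tauto
  exact Nat.card_congr
    { toFun := fun T => ⟨T.1.transpose hμ, h1 _ T.2⟩
      invFun := fun T => ⟨T.1.transpose hμ, h2 _ T.2⟩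
      left_inv := fun T => Subtype.ext (T.1.transpose_transpose hμ)
      right_inv := fun T => Subtype.ext (T.1.transpose_transpose hμ) }

/-! ### A determinant of binomial coefficients. -/

section BinomialDeterminant

theorem coeffZ_add {R : Type*} [CommRing R] (F G : PowerSeries R) (n : ℤ) :
    coeffZ (F + G) n = coeffZ F n + coeffZ G n := by
  unfold coeffZ
  split_ifs <;> simp

theorem coeffZ_mul_X_pow {R : Type*} [CommRing R] (G : PowerSeries R) (t : ℕ) (n : ℤ) :
    coeffZ (G * PowerSeries.X ^ t) n = coeffZ G (n - t) := by
  rcases lt_or_ge n 0 with h | h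
  · rw [coeffZ_of_neg _ h, coeffZ_of_neg _ (by omega)]
  · lift n to ℕ using h
    rw [coeffZ_natCast, PowerSeries.coeff_mul_X_pow']
    split_ifs with ht
    · rw [← Nat.cast_sub ht, coeffZ_natCast]
    · rw [coeffZ_of_neg _ (by omega)]

theorem coeffZ_mul_one_add_X_pow {R : Type*} [CommRing R] (G : PowerSeries R) (m : ℕ) (n : ℤ) :
    coeffZ (G * (1 + PowerSeries.X) ^ m) n =
      ∑ t ∈ Finset.range (m + 1), coeffZ G (n - t) * (m.choose t : R) := by
  let φ : PowerSeries R →+ R :=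
    { toFun := fun F => coeffZ F n
      map_zero' := by simp [coeffZ]
      map_add' := fun F G => coeffZ_add F G n }
  change φ _ = _
  rw [add_comm, add_pow, Finset.mul_sum, map_sum]
  refine Finset.sum_congr rfl fun t _ => ?_
  rw [one_pow, mul_one, ← mul_assoc, mul_comm _ ((m.choose t : ℕ) : PowerSeries R), ← nsmul_eq_mul,
    map_nsmul, nsmul_eq_mul, mul_comm, ← coeffZ_mul_X_pow]
  rfl

/-- Each column receives a binomial combination of the later ones. The exponent `l - 1 - j` is the
number of later columns, so the combination never leaves the matrix. -/
theorem altDet_column_operations {R : Type*} [CommRing R] (G : PowerSeries R) {l : ℕ}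
    (ν : Fin l → ℤ) :
    altDet G ν = Matrix.det (Matrix.of fun i j : Fin l =>
      coeffZ (G * (1 + PowerSeries.X) ^ (l - 1 - (j : ℕ))) (ν i - (j : ℕ))) := by
  let P : Matrix (Fin l) (Fin l) R := Matrix.of fun k j =>
    if j ≤ k then ((l - 1 - (j : ℕ)).choose (k - j) : R) else 0
  have hP : P.det = 1 := by
    rw [Matrix.det_of_isLowerTriangular]
    · refine Finset.prod_eq_one fun i _ => ?_
      simp [P]
    · intro i j hij
      exact if_neg (not_le.mpr hij)
  unfold altDet
  rw [← mul_one (Matrix.det _), ← hP, ← Matrix.det_mul]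
  congr 1
  ext i j
  rw [Matrix.mul_apply, Matrix.of_apply, coeffZ_mul_one_add_X_pow]
  simp only [P, Matrix.of_apply, Fin.le_def]
  rw [← Finset.sum_range fun k : ℕ => coeffZ G (ν i - (k : ℕ)) *
    if (j : ℕ) ≤ k then ((l - 1 - (j : ℕ)).choose (k - j) : R) else 0]
  have hj := j.2
  have hl : Finset.range l = Finset.range ((j : ℕ) + (l - 1 - j + 1)) := by congr 1; omega
  rw [hl, Finset.sum_range_add, Finset.sum_eq_zero, zero_add]
  · refine Finset.sum_congr rfl fun t _ => ?_
    rw [if_pos (Nat.le_add_right _ _), Nat.add_sub_cancel_left, Nat.cast_add, sub_sub]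
  · intro k hk
    rw [Finset.mem_range] at hk
    rw [if_neg (by omega), mul_zero]

theorem factorial_mul_choose (M : ℂ[X]) (q : ℕ) :
    (q.factorial : ℂ[X]) * Ring.choose M q = ∏ t ∈ Finset.range q, (M - (t : ℂ[X])) := by
  rw [← nsmul_eq_mul, ← Ring.descPochhammer_eq_factorial_smul_choose, ← Polynomial.aeval_eq_smeval]
  induction q with
  | zero => simp
  | succ q ih => rw [descPochhammer_succ_right, map_mul, ih, Finset.prod_range_succ]; simp

/-- Falling factorials are monic polynomials, so this is a Vandermonde determinant at 1, 3, 5, …. -/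
theorem det_descFactorial_odd (l : ℕ) :
    Matrix.det (Matrix.of fun i j : Fin l => ((2 * (i : ℕ) + 1).descFactorial j : ℤ)) =
      ∏ i ∈ Finset.range l, (2 ^ i * (i.factorial : ℤ)) := by
  have h := Matrix.det_eval_matrixOfPolynomials_eq_det_vandermonde
    (fun i : Fin l => (2 * (i : ℕ) + 1 : ℤ)) (fun j => descPochhammer ℤ j)
    (fun j => descPochhammer_natDegree ℤ j) (fun j => monic_descPochhammer ℤ j)
  have e : (Matrix.of fun i j : Fin l => ((2 * (i : ℕ) + 1).descFactorial j : ℤ)) =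
      Matrix.of fun i j : Fin l => (descPochhammer ℤ j).eval (2 * (i : ℕ) + 1 : ℤ) := by
    ext i j
    rw [Matrix.of_apply, Matrix.of_apply, ← descPochhammer_eval_eq_descFactorial]
    push_cast
    rfl
  rw [e, ← h, Matrix.det_vandermonde_add (fun i : Fin l => (2 * (i : ℕ) : ℤ)) 1]
  have e2 : Matrix.vandermonde (fun i : Fin l => (2 * (i : ℕ) : ℤ)) =
      Matrix.of fun i j : Fin l => 2 ^ (j : ℕ) * Matrix.vandermonde (fun i : Fin l => (i : ℤ)) i j := by
    ext i j
    simp [Matrix.vandermonde_apply, mul_pow]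
  rw [e2, Matrix.det_mul_row, Finset.prod_mul_distrib, Finset.prod_range]
  congr 1
  cases l with
  | zero => simp
  | succ l =>
    rw [Matrix.det_vandermonde_id_eq_superFactorial, ← Nat.prod_range_succ_factorial, Nat.cast_prod]

theorem doubleFactorial_two_mul_add_one (n : ℕ) :
    Nat.doubleFactorial (2 * n + 1) = ∏ t ∈ Finset.range (n + 1), (2 * t + 1) := by
  induction n with
  | zero => simp
  | succ n ih => 
    rw [Finset.prod_range_succ, ← ih, show 2 * (n + 1) + 1 = 2 * n + 1 + 2 by ring,
      Nat.doubleFactorial_add_two, mul_comm]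

/-- After the column operations the entry is the binomial coefficient of `M - j` over `q - j`, with
`q = 2i + 1`. Scaling the row by `q!` and the column by `D j` turns it into `D q` times the falling
factorial of `q`, leaving a numerical determinant. The `D j` then cancel against the first `i`
factors of each `D (2i + 1)`; `hN` makes this legitimate. -/
theorem altDet_binomialSeries (l : ℕ) (N : ℂ[X])
    (hN : ∀ t : ℕ, N + ((l - 1 : ℕ) : ℂ[X]) - (t : ℂ[X]) ≠ 0) :
    altDet (binomialSeries ℂ[X] N) (fun i : Fin l => ((2 * (i : ℕ) + 1 : ℕ) : ℤ)) *
      ((∏ i ∈ Finset.range l, Nat.doubleFactorial (2 * i + 1) : ℕ) : ℂ[X]) =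
    ∏ i ∈ Finset.range l, ∏ s ∈ Finset.range (i + 1),
      (N + ((l - 1 : ℕ) : ℂ[X]) - ((i + s : ℕ) : ℂ[X])) := by
  set M : ℂ[X] := N + ((l - 1 : ℕ) : ℂ[X]) with hM
  let D (q : ℕ) : ℂ[X] := ∏ t ∈ Finset.range q, (M - (t : ℂ[X]))
  have hD (q : ℕ) : D q ≠ 0 := Finset.prod_ne_zero_iff.mpr fun t _ => hN t
  have hrow : (∏ i : Fin l, ((2 * (i : ℕ) + 1).factorial : ℂ[X])) * ((∏ j : Fin l, D j) *
      altDet (binomialSeries ℂ[X] N) (fun i : Fin l => ((2 * (i : ℕ) + 1 : ℕ) : ℤ))) =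
      (∏ i : Fin l, D (2 * (i : ℕ) + 1)) * Matrix.det (Matrix.of fun i j : Fin l =>
        ((2 * (i : ℕ) + 1).descFactorial j : ℂ[X])) := by
    rw [altDet_column_operations, ← Matrix.det_mul_row, ← Matrix.det_mul_column,
      ← Matrix.det_mul_column]
    congr 1
    ext1 i j
    simp only [Matrix.of_apply]
    rw [← PowerSeries.binomialSeries_nat (R := ℂ[X]), ← PowerSeries.binomialSeries_add]
    generalize hq : 2 * (i : ℕ) + 1 = q
    rcases lt_or_ge q (j : ℕ) with h | h
    · rw [coeffZ_of_neg _ (by omega), Nat.descFactorial_of_lt h]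
      simp
    · rw [← Nat.cast_sub h, coeffZ_natCast, PowerSeries.binomialSeries_coeff, smul_eq_mul, mul_one]
      have hj := j.2
      have hMj : N + ((l - 1 - (j : ℕ) : ℕ) : ℂ[X]) = M - ((j : ℕ) : ℂ[X]) := by
        rw [hM, Nat.cast_sub (by omega)]
        ring
      have h1 := factorial_mul_choose (M - ((j : ℕ) : ℂ[X])) (q - j)
      have h2 : D q = D j * ∏ t ∈ Finset.range (q - j), (M - ((j : ℕ) : ℂ[X]) - (t : ℂ[X])) := by
        simp only [D]
        conv_lhs => rw [← Nat.add_sub_of_le h]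
        rw [Finset.prod_range_add]
        congr 1
        refine Finset.prod_congr rfl fun t _ => ?_
        push_cast
        ring
      rw [hMj, h2, ← h1, ← Nat.factorial_mul_descFactorial h]
      push_cast
      ring
  have hdet : Matrix.det (Matrix.of fun i j : Fin l =>
      ((2 * (i : ℕ) + 1).descFactorial j : ℂ[X])) =
      ∏ i : Fin l, ((2 ^ (i : ℕ) * (i : ℕ).factorial : ℕ) : ℂ[X]) := by
    have h := congrArg (Int.castRingHom ℂ[X]) (det_descFactorial_odd l)
    rw [RingHom.map_det, map_prod, Finset.prod_range] at h
    convert h using 2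
    · ext1 i j; simp
    · simp
  have hfac (i : ℕ) : (2 * i + 1).factorial =
      (2 * i + 1).doubleFactorial * (2 ^ i * i.factorial) := by
    rw [Nat.factorial_eq_mul_doubleFactorial, Nat.doubleFactorial_two_mul]
  have hsplit (i : ℕ) : D (2 * i + 1) =
      D i * ∏ s ∈ Finset.range (i + 1), (M - ((i + s : ℕ) : ℂ[X])) := by
    simp only [D]
    rw [show 2 * i + 1 = i + (i + 1) by omega, Finset.prod_range_add]
  simp only [hdet, hfac, hsplit, Nat.cast_mul, Finset.prod_mul_distrib] at hrow
  have hne : (∏ i : Fin l, D i) * ((∏ i : Fin l, ((2 ^ (i : ℕ) : ℕ) : ℂ[X])) *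
      ∏ i : Fin l, ((i : ℕ).factorial : ℂ[X])) ≠ 0 := by
    refine mul_ne_zero (Finset.prod_ne_zero_iff.mpr fun i _ => hD i) (mul_ne_zero
      (Finset.prod_ne_zero_iff.mpr fun i _ => ?_) (Finset.prod_ne_zero_iff.mpr fun i _ => ?_))
    · simp
    · exact Nat.cast_ne_zero.mpr (Nat.factorial_ne_zero _)
  refine mul_left_cancel₀ hne ?_
  rw [Finset.prod_range, Finset.prod_range, Nat.cast_prod]
  linear_combination hrow

end BinomialDeterminant

/-! ### Hooks and contents of staircases. -/

section Staircase

theorem mem_staircase {m : ℕ} {c : ℕ × ℕ} : c ∈ staircase m ↔ c.1 + c.2 + 1 < m := by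
  rw [← YoungDiagram.mem_cells]
  simp only [staircase, Finset.mem_filter, Finset.mem_product, Finset.mem_range]
  omega

theorem rowLen_staircase (m i : ℕ) : (staircase m).rowLen i = m - 1 - i := by
  have h : ∀ j, j < (staircase m).rowLen i ↔ j < m - 1 - i := fun j => by
    rw [← YoungDiagram.mem_iff_lt_rowLen, mem_staircase]
    simp only
    omega
  exact le_antisymm (not_lt.mp fun c => lt_irrefl _ ((h _).mp c))
    (not_lt.mp fun c => lt_irrefl _ ((h _).mpr c))

theorem colLen_staircase (m j : ℕ) : (staircase m).colLen j = m - 1 - j := by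
  have h : ∀ i, i < (staircase m).colLen j ↔ i < m - 1 - j := fun i => by
    rw [← YoungDiagram.mem_iff_lt_colLen, mem_staircase]
    simp only
    omega
  exact le_antisymm (not_lt.mp fun c => lt_irrefl _ ((h _).mp c))
    (not_lt.mp fun c => lt_irrefl _ ((h _).mpr c))

theorem prod_staircase {M : Type*} [CommMonoid M] (l : ℕ) (f : ℕ × ℕ → M) :
    ∏ c ∈ (staircase (l + 1)).cells, f c =
      ∏ i ∈ Finset.range l, ∏ j ∈ Finset.range (l - i), f (i, j) := by
  refine Finset.prod_finset_product _ _ _ fun c => ?_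
  rw [YoungDiagram.mem_cells, mem_staircase, Finset.mem_range, Finset.mem_range]
  omega

/-- The hook lengths along a row of `r` cells are `2r - 1, …, 3, 1`. -/
theorem hookProduct_staircase (l : ℕ) :
    hookProduct (staircase (l + 1)) =
      ∏ i ∈ Finset.range l, Nat.doubleFactorial (2 * i + 1) := by
  rw [hookProduct, prod_staircase, ← Finset.prod_range_reflect]
  refine Finset.prod_congr rfl fun i hi => ?_
  rw [Finset.mem_range] at hi
  rw [doubleFactorial_two_mul_add_one, ← Finset.prod_range_reflect]
  refine Finset.prod_congr (by congr 1; omega) fun j hj => ?_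
  rw [Finset.mem_range] at hj
  simp only [hookLength, rowLen_staircase, colLen_staircase]
  omega

theorem card_staircase (l : ℕ) :
    (staircase (l + 1)).card = ∑ i : Fin l, ((i : ℕ) + 1) := by
  have h := prod_staircase l fun _ => Multiplicative.ofAdd 1
  simp only [Finset.prod_const, Finset.card_range, ← ofAdd_nsmul, ← ofAdd_sum, smul_eq_mul,
    mul_one, EmbeddingLike.apply_eq_iff_eq] at h
  rw [YoungDiagram.card, h, ← Finset.sum_range_reflect, Finset.sum_range]
  refine Finset.sum_congr rfl fun i _ => ?_
  have := i.2
  omega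

/-- The even factor `(1 + x²)^(-β)` cancels the power of `1 - Ix`, and with it the dependence on
`ε`, that is, on the parity of the number of cells. -/
theorem altDet_tanSeries_staircase (l : ℕ) (ε : ℂ) :
    altDet (tanSeries ε) (fun i : Fin l => ((2 * (i : ℕ) + 1 : ℕ) : ℤ)) =
      altDet (rescale (C Complex.I) (binomialSeries ℂ[X] (C (-Complex.I) * X)))
        (fun i : Fin l => ((2 * (i : ℕ) + 1 : ℕ) : ℤ)) := by
  let β : ℂ[X] := C (Complex.I / 2) * X - C (ε / 2)
  rw [← altDet_mul_even (tanSeries ε) (arcSeries (-β) (-β)) (constantCoeff_arcSeries _ _)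
    (coeff_arcSeries_self _), tanSeries, arcSeries_mul]
  have h1 : C (-Complex.I / 2) * X - C (ε / 2) + -β = C (-Complex.I) * X := by
    have : C (-Complex.I) = C (-Complex.I / 2) - C (Complex.I / 2) := by
      rw [← C_sub]
      congr 1
      ring
    rw [this]
    simp only [β]
    ring
  have h2 : C (Complex.I / 2) * X - C (ε / 2) + -β = 0 := by simp [β]
  rw [h1, h2, arcSeries, PowerSeries.binomialSeries_zero, map_one, mul_one]

/-- The content polynomial of a staircase, with contents multiplied by the imaginary unit. -/
def contentPoly (l : ℕ) : ℂ[X] :=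
  ∏ p ∈ Finset.range l, ∏ s ∈ Finset.range (l - p), (X + C (Complex.I * ((p : ℂ) - (s : ℂ))))

/-- Rescaling leaves one factor `I` per cell, which turns `-I E + c` into `E + I c`. -/
theorem altDet_tanSeries_mul_hookProduct (l : ℕ) (ε : ℂ) :
    altDet (tanSeries ε) (fun i : Fin l => ((2 * (i : ℕ) + 1 : ℕ) : ℤ)) *
      (hookProduct (staircase (l + 1)) : ℂ[X]) = contentPoly l := by
  have hI0 : (C Complex.I : ℂ[X]) ≠ 0 := by simp
  have hfac (z : ℂ) : C (-Complex.I) * X + C z = C (-Complex.I) * (X + C (Complex.I * z)) := by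
    rw [mul_add, ← C_mul]
    congr 2
    linear_combination z * Complex.I_mul_I
  have hN (t : ℕ) : C (-Complex.I) * X + ((l - 1 : ℕ) : ℂ[X]) - (t : ℂ[X]) ≠ 0 := by
    rw [add_sub_assoc, ← C_eq_natCast, ← C_eq_natCast, ← C_sub, hfac]
    exact mul_ne_zero (by simp) (X_add_C_ne_zero _)
  have h1 := altDet_binomialSeries l (C (-Complex.I) * X) hN
  have h2 := altDet_rescale (C Complex.I) (binomialSeries ℂ[X] (C (-Complex.I) * X))
    fun i : Fin l => 2 * (i : ℕ) + 1
  have h3 : ∑ i : Fin l, (2 * (i : ℕ) + 1) = ∑ i : Fin l, ((i : ℕ) + 1) + ∑ i : Fin l, (i : ℕ) := by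
    rw [← Finset.sum_add_distrib]
    exact Finset.sum_congr rfl fun i _ => by ring
  rw [h3, pow_add, mul_right_comm] at h2
  have h4 := mul_right_cancel₀ (pow_ne_zero _ hI0) h2
  rw [altDet_tanSeries_staircase, h4, hookProduct_staircase, mul_assoc, h1,
    ← Finset.sum_range fun i => i + 1, ← Finset.prod_pow_eq_pow_sum, ← Finset.prod_mul_distrib,
    contentPoly, ← Finset.prod_range_reflect]
  refine Finset.prod_congr rfl fun i hi => ?_
  rw [Finset.mem_range] at hi
  have hc : (C Complex.I : ℂ[X]) ^ (l - 1 - i + 1) * ∏ s ∈ Finset.range (l - 1 - i + 1),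
      (C (-Complex.I) * X + ((l - 1 : ℕ) : ℂ[X]) - ((l - 1 - i + s : ℕ) : ℂ[X])) =
      ∏ s ∈ Finset.range (l - i), (X + C (Complex.I * ((i : ℂ) - (s : ℂ)))) := by
    have hpow : (C Complex.I : ℂ[X]) ^ (l - 1 - i + 1) =
        ∏ s ∈ Finset.range (l - 1 - i + 1), C Complex.I := by simp
    rw [hpow, ← Finset.prod_mul_distrib, show l - i = l - 1 - i + 1 by omega]
    refine Finset.prod_congr rfl fun s _ => ?_
    rw [add_sub_assoc, ← C_eq_natCast, ← C_eq_natCast, ← C_sub, hfac, ← mul_assoc, ← C_mul]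
    have e1 : Complex.I * -Complex.I = 1 := by linear_combination -Complex.I_mul_I
    have e2 : ((l - 1 : ℕ) : ℂ) - ((l - 1 - i + s : ℕ) : ℂ) = (i : ℂ) - (s : ℂ) := by
      have : l - 1 = l - 1 - i + i := by omega
      rw [congrArg (Nat.cast : ℕ → ℂ) this]
      push_cast
      ring
    rw [e1, e2, C_1, one_mul]
  exact hc

theorem prod_Icc_one {M : Type*} [CommMonoid M] (n : ℕ) (f : ℕ → M) :
    ∏ j ∈ Finset.Icc 1 n, f j = ∏ s ∈ Finset.range n, f (s + 1) := by
  rw [Finset.range_eq_Ico, Finset.prod_Ico_add' f 0 n 1]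
  rfl

/-- Deleting the first row and column keeps the contents of the remaining cells and leaves a smaller
staircase; the deleted hook has contents `0, ±1, …, ±(l + 1)`. -/
theorem contentPoly_add_two (l : ℕ) :
    contentPoly (l + 2) =
      contentPoly l * (X * ∏ j ∈ Finset.Icc 1 (l + 1), (X ^ 2 + C ((j : ℂ) ^ 2))) := by
  have hin : ∀ p ∈ Finset.range (l + 1), ∏ s ∈ Finset.range (l + 2 - (p + 1)),
      (X + C (Complex.I * (((p + 1 : ℕ) : ℂ) - (s : ℂ)))) =
      (∏ s ∈ Finset.range (l - p), (X + C (Complex.I * ((p : ℂ) - (s : ℂ))))) *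
        (X + C (Complex.I * ((p : ℂ) + 1))) := by
    intro p hp
    rw [Finset.mem_range] at hp
    rw [show l + 2 - (p + 1) = l - p + 1 by omega, Finset.prod_range_succ']
    simp only [Nat.cast_add, Nat.cast_one, Nat.cast_zero, sub_zero, add_sub_add_right_eq_sub]
  rw [contentPoly, Finset.prod_range_succ', Finset.prod_congr rfl hin, Finset.prod_mul_distrib,
    Finset.prod_range_succ (n := l), Nat.sub_self, Finset.prod_range_zero, mul_one, Nat.sub_zero,
    Finset.prod_range_succ' (n := l + 1), contentPoly, mul_assoc, prod_Icc_one]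
  congr 1
  simp only [Nat.cast_zero, sub_zero, mul_zero, C_0, add_zero]
  rw [← mul_assoc, mul_comm _ X, ← Finset.prod_mul_distrib]
  congr 1
  refine Finset.prod_congr rfl fun s _ => ?_
  push_cast
  have hI : (C Complex.I : ℂ[X]) * C Complex.I = -1 := by
    rw [← C_mul, Complex.I_mul_I, C_neg, C_1]
  simp only [zero_sub, mul_neg, C_neg, C_mul, C_pow, C_add, C_1]
  linear_combination (-(C (s : ℂ) + 1) ^ 2) * hI

/-- Pairing opposite contents of an even staircase. -/
theorem contentPoly_even (k : ℕ) :
    contentPoly (2 * k - 1) = X ^ k * ∏ j ∈ Finset.Icc 1 (2 * k - 2),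
      (X ^ 2 + C ((j : ℂ) ^ 2)) ^ (k - (j + 1) / 2) := by
  rcases Nat.eq_zero_or_pos k with rfl | hk
  · simp [contentPoly]
  induction k, hk using Nat.le_induction with
  | base => simp [contentPoly]
  | succ k hk ih =>
    -- The two added factors, at `j = 2k - 1` and `j = 2k`, have exponent zero; they become simple
    -- factors at the next step.
    have hext : ∏ j ∈ Finset.Icc 1 (2 * k - 2),
        (X ^ 2 + C ((j : ℂ) ^ 2)) ^ (k - (j + 1) / 2) = ∏ j ∈ Finset.Icc 1 (2 * k),
        (X ^ 2 + C ((j : ℂ) ^ 2)) ^ (k - (j + 1) / 2) := by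
      refine Finset.prod_subset (Finset.Icc_subset_Icc_right (by omega)) fun j hj hj' => ?_
      rw [Finset.mem_Icc] at hj hj'
      rw [show k - (j + 1) / 2 = 0 by omega, pow_zero]
    rw [show 2 * (k + 1) - 1 = 2 * k - 1 + 2 by omega, contentPoly_add_two, ih, hext,
      show 2 * k - 1 + 1 = 2 * k by omega, show 2 * (k + 1) - 2 = 2 * k by omega,
      mul_mul_mul_comm, ← pow_succ, ← Finset.prod_mul_distrib]
    congr 1
    refine Finset.prod_congr rfl fun j hj => ?_
    rw [Finset.mem_Icc] at hj
    rw [← pow_succ, show k - (j + 1) / 2 + 1 = k + 1 - (j + 1) / 2 by omega]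

/-- Pairing opposite contents of an odd staircase. -/
theorem contentPoly_odd (k : ℕ) :
    contentPoly (2 * k) = X ^ k * ∏ j ∈ Finset.Icc 1 (2 * k - 1),
      (X ^ 2 + C ((j : ℂ) ^ 2)) ^ (k - j / 2) := by
  induction k with
  | zero => simp [contentPoly]
  | succ k ih =>
    have hext : ∏ j ∈ Finset.Icc 1 (2 * k - 1),
        (X ^ 2 + C ((j : ℂ) ^ 2)) ^ (k - j / 2) = ∏ j ∈ Finset.Icc 1 (2 * k + 1),
        (X ^ 2 + C ((j : ℂ) ^ 2)) ^ (k - j / 2) := by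
      refine Finset.prod_subset (Finset.Icc_subset_Icc_right (by omega)) fun j hj hj' => ?_
      rw [Finset.mem_Icc] at hj hj'
      rw [show k - j / 2 = 0 by omega, pow_zero]
    rw [show 2 * (k + 1) = 2 * k + 2 by omega, contentPoly_add_two, ih, hext,
      show 2 * k + 2 - 1 = 2 * k + 1 by omega,
      mul_mul_mul_comm, ← pow_succ, ← Finset.prod_mul_distrib]
    congr 1
    refine Finset.prod_congr rfl fun j hj => ?_
    rw [Finset.mem_Icc] at hj
    rw [← pow_succ, show k - j / 2 + 1 = k + 1 - j / 2 by omega]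

theorem alt_staircase_mul_hookProduct (l : ℕ) :
    (alt (staircase (l + 1)) : ℂ) * (hookProduct (staircase (l + 1)) : ℂ) =
      umbralMap (fun n => (eulerNumber n : ℂ)) (contentPoly l) := by
  have hl : ∀ c ∈ staircase (l + 1), c.1 < l := fun c hc => by
    rw [mem_staircase] at hc
    omega
  have ha : (fun i : Fin l => ((staircase (l + 1)).rowLen i.rev : ℤ)) =
      fun i : Fin l => ((i : ℕ) : ℤ) + 1 := by
    ext i
    have := i.2
    rw [rowLen_staircase, Fin.val_rev]
    omega
  rw [alt_eq_altCount hl, ha, altCount_monotone_eq_altValue eulerRecurrence_eulerNumber, altValue]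
  · have hν : (fun i : Fin l => ((i : ℕ) : ℤ) + 1 + ((i : ℕ) : ℤ)) =
        fun i : Fin l => ((2 * (i : ℕ) + 1 : ℕ) : ℤ) := by
      ext i
      push_cast
      ring
    rw [hν, ← altDet_tanSeries_mul_hookProduct l, mul_comm (altDet _ _), ← C_eq_natCast,
      umbralMap_C_mul, mul_comm]
  · intro i j hij
    have : (i : ℕ) ≤ j := hij
    simp only
    omega
  · intro i
    positivity
  · rw [card_staircase]
    push_cast
    rfl

theorem staircase_zero : staircase 0 = staircase (0 + 1) := by
  ext c
  rw [YoungDiagram.mem_cells, YoungDiagram.mem_cells, mem_staircase, mem_staircase]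
  omega

theorem hookProduct_ne_zero (μ : YoungDiagram) : hookProduct μ ≠ 0 :=
  Finset.prod_ne_zero_iff.mpr fun _ _ => Nat.succ_ne_zero _

theorem umbral_cast (p : ℚ[X]) :
    ((umbral p : ℚ) : ℂ) =
      umbralMap (fun n => (eulerNumber n : ℂ)) (p.map (algebraMap ℚ ℂ)) := by
  rw [umbralMap_apply, sum_def, umbral, sum_def, Rat.cast_sum,
    support_map_of_injective _ (algebraMap ℚ ℂ).injective]
  refine Finset.sum_congr rfl fun n _ => ?_
  simp

theorem alt_staircase (m : ℕ) (p : ℚ[X]) (hp : p.map (algebraMap ℚ ℂ) = contentPoly (m - 1)) :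
    (alt (staircase m) : ℚ) = umbral p / (hookProduct (staircase m) : ℚ) := by
  rw [eq_div_iff (Nat.cast_ne_zero.mpr (hookProduct_ne_zero _)),
    ← (Rat.cast_injective (α := ℂ)).eq_iff, umbral_cast, hp]
  push_cast
  cases m with
  | zero => rw [staircase_zero]; exact alt_staircase_mul_hookProduct 0
  | succ l => exact alt_staircase_mul_hookProduct l

end Staircase

end AlternatingTableaux

end

open AlternatingTableaux
/-- For natural numbers, `(j + 1) / 2 = ⌈j/2⌉` and `j / 2 = ⌊j/2⌋`. For `m ≤ 2` the products over
`1 ≤ j ≤ m - 2` are empty; otherwise none of the subtractions below truncates. -/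
theorem mainTheorem4 (m k : ℕ) :
    (m = 2 * k →
      alt (staircase m) = ralt (staircase m) ∧
      (alt (staircase m) : ℚ) =
        umbral (X ^ k * ∏ j ∈ Finset.Icc 1 (m - 2), (X ^ 2 + C ((j : ℚ) ^ 2)) ^ (k - (j + 1) / 2))
          / (hookProduct (staircase m) : ℚ)) ∧
    (m = 2 * k + 1 →
      alt (staircase m) = ralt (staircase m) ∧
      (alt (staircase m) : ℚ) =
        umbral (X ^ k * ∏ j ∈ Finset.Icc 1 (m - 2), (X ^ 2 + C ((j : ℚ) ^ 2)) ^ (k - j / 2))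
          / (hookProduct (staircase m) : ℚ)) := by
  have hswap : ∀ c, c.swap ∈ staircase m ↔ c ∈ staircase m := fun c => by
    rw [mem_staircase, mem_staircase, Prod.fst_swap, Prod.snd_swap, add_comm c.2]
  refine ⟨fun h => ⟨alt_eq_ralt hswap, alt_staircase m _ ?_⟩,
    fun h => ⟨alt_eq_ralt hswap, alt_staircase m _ ?_⟩⟩
  · rw [h, contentPoly_even]
    simp [Polynomial.map_prod]
  · rw [h, Nat.add_sub_cancel, contentPoly_odd]
    simp [Polynomial.map_prod]
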